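/- Let $\Omega\subset\mathbb R^4$ be a bounded open set and let $g:\Omega\to[0,\infty]$ be Lebesgue measurable. Write $|A|$ for the Lebesgue measure of $A$. For $t>0$ let $$g^*(t)=\inf\{s>0:\ |\{x\in\Omega: g(x)>s\}|<t\},\qquad g^{**}(t)=\frac1t\int_0^t g^*(\tau)\,d\tau ,$$ and say that $g\in\mathcal M\log L(\Omega)$ if $$\sup_{0<t<|\Omega|} t\,\log\!\Big(\frac{|\Omega|}{t}\Big)\,g^{**}(t)<\infty .$$ Let $H^2_0(\Omega)$ be the closure of $C_c^\infty(\Omega)$ in the (real) Sobolev space $H^2(\Omega)=W^{2,2}(\Omega)$. The weight $g$ is called admissible on $\Omega$ if $g\in L^1_{loc}(\Omega)$ and there is a constant $C>0$ such that $$\int_\Omega g\,u^2\,dx\le C\int_\Omega|\Delta u|^2\,dx\qquad\text{for all }u\in H^2_0(\Omega).$$ (i) If $g\in\mathcal M\log L(\Omega)$, then $g$ is admissible on $\Omega$. (ii) Suppose in addition that $\Omega$ is an open ball of radius $R\in(0,\infty)$ centered at the origin, and that $g$ is radial and radially decreasing, i.e. $g(x)=g(y)$ whenever $x,y\in\Omega$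 and $|x|=|y|$, and $g(y)\le g(x)$ whenever $x,y\in\Omega$ and $|x|\le|y|$. If $g$ is admissible on $\Omega$, then $g\in\mathcal M\log L(\Omega)$. -/

import Mathlib

open MeasureTheory Set Filter Topology TopologicalSpace
open scoped ENNReal Distributions

namespace HardyRellich

/-- The Euclidean space of dimension `N`, with its Euclidean norm and Lebesgue measure. -/
abbrev E (N : ℕ) : Type := EuclideanSpace ℝ (Fin N)

section Rearrangement

variable {N : ℕ}

/-- The distribution function `α_g(s) = |{x ∈ Ω : g x > s}|` of a nonnegative extended real
valued function `g` on `Ω`. -/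
noncomputable def distribution (Ω : Opens (E N)) (g : E N → ℝ≥0∞) (s : ℝ≥0∞) : ℝ≥0∞ :=
  volume {x : E N | x ∈ Ω ∧ s < g x}

/-- The one dimensional decreasing rearrangement `g^*(t) = inf {s > 0 : α_g(s) < t}`, `t > 0`. -/
noncomputable def rearrangement (Ω : Opens (E N)) (g : E N → ℝ≥0∞) (t : ℝ) : ℝ≥0∞ :=
  sInf {s : ℝ≥0∞ | 0 < s ∧ distribution Ω g s < ENNReal.ofReal t}

/-- The maximal function `g^{**}(t) = (1 / t) ∫_0^t g^*(τ) dτ`, `t > 0`. -/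
noncomputable def maximalRearrangement (Ω : Opens (E N)) (g : E N → ℝ≥0∞) (t : ℝ) : ℝ≥0∞ :=
  (ENNReal.ofReal t)⁻¹ * ∫⁻ τ in Ioo 0 t, rearrangement Ω g τ

/-- The quantity `sup_{0 < t < |Ω|} t log (|Ω| / t) g^{**}(t)`, for `Ω` of finite measure. -/
noncomputable def mLogLNorm (Ω : Opens (E N)) (g : E N → ℝ≥0∞) : ℝ≥0∞ :=
  ⨆ t ∈ Ioo (0 : ℝ) (volume.real (Ω : Set (E N))),
    ENNReal.ofReal (t * Real.log (volume.real (Ω : Set (E N)) / t)) * maximalRearrangement Ω g t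

/-- Membership of a nonnegative function in the space `𝓜 log L(Ω)`, for `Ω` of finite measure.
Here (Lebesgue) measurability on `Ω` is `AEMeasurable` for the restricted measure. -/
def MemMLogL (Ω : Opens (E N)) (g : E N → ℝ≥0∞) : Prop :=
  AEMeasurable g (volume.restrict (Ω : Set (E N))) ∧ mLogLNorm Ω g < ∞

end Rearrangement

section Sobolev

variable {N : ℕ}

/-- The classical partial derivative `∂_i f`. -/
noncomputable def partialDeriv (i : Fin N) (f : E N → ℝ) (x : E N) : ℝ :=
  fderiv ℝ f x (EuclideanSpace.single i 1)

/-- `v` is the weak partial derivative `∂_i u` on `Ω` (used for `u`, `v` in `L²(Ω)`). -/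
def IsWeakPartial (Ω : Opens (E N)) (i : Fin N) (u v : E N → ℝ) : Prop :=
  ∀ φ : 𝓓(Ω, ℝ),
    ∫ x in (Ω : Set (E N)), u x * partialDeriv i φ x = - ∫ x in (Ω : Set (E N)), v x * φ x

/-- `u` belongs to `H²(Ω) = W^{2,2}(Ω)`, with weak gradient `G` and weak Hessian `H`. -/
structure IsH2 (Ω : Opens (E N)) (u : E N → ℝ) (G : Fin N → E N → ℝ)
    (H : Fin N → Fin N → E N → ℝ) : Prop where
  memLp : MemLp u 2 (volume.restrict (Ω : Set (E N)))
  memLp_grad : ∀ i, MemLp (G i) 2 (volume.restrict (Ω : Set (E N)))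
  memLp_hess : ∀ i j, MemLp (H i j) 2 (volume.restrict (Ω : Set (E N)))
  weak_grad : ∀ i, IsWeakPartial Ω i u (G i)
  weak_hess : ∀ i j, IsWeakPartial Ω j (G i) (H i j)

/-- `u` belongs to `H²₀(Ω)`, the closure of `C_c^∞(Ω)` in `H²(Ω)`; `G` and `H` are its weak
gradient and its weak Hessian. -/
structure IsH20 (Ω : Opens (E N)) (u : E N → ℝ) (G : Fin N → E N → ℝ)
    (H : Fin N → Fin N → E N → ℝ) : Prop extends IsH2 Ω u G H where
  approx : ∃ φ : ℕ → 𝓓(Ω, ℝ),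
    Tendsto (fun n ↦ eLpNorm (fun x ↦ u x - φ n x) 2
      (volume.restrict (Ω : Set (E N)))) atTop (𝓝 0) ∧
    (∀ i, Tendsto (fun n ↦ eLpNorm (fun x ↦ G i x - partialDeriv i (φ n) x) 2
      (volume.restrict (Ω : Set (E N)))) atTop (𝓝 0)) ∧
    (∀ i j, Tendsto (fun n ↦ eLpNorm
      (fun x ↦ H i j x - partialDeriv j (partialDeriv i (φ n)) x) 2
      (volume.restrict (Ω : Set (E N)))) atTop (𝓝 0))

/-- The Laplacian, as the trace of the Hessian. -/
def laplacianOfHessian (H : Fin N → Fin N → E N → ℝ) (x : E N) : ℝ := ∑ i, H i i x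

/-- A nonnegative weight `g` is admissible on `Ω` if it is in `L¹_loc(Ω)` and if there is a
constant `C > 0` such that `∫_Ω g u² ≤ C ∫_Ω |Δu|²` for all `u ∈ H²₀(Ω)`. -/
def Admissible (Ω : Opens (E N)) (g : E N → ℝ≥0∞) : Prop :=
  AEMeasurable g (volume.restrict (Ω : Set (E N))) ∧
  (∀ K : Set (E N), IsCompact K → K ⊆ Ω → ∫⁻ x in K, g x < ∞) ∧
  ∃ C : ℝ, 0 < C ∧ ∀ (u : E N → ℝ) (G : Fin N → E N → ℝ) (H : Fin N → Fin N → E N → ℝ),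
    IsH20 Ω u G H →
      ∫⁻ x in (Ω : Set (E N)), g x * ENNReal.ofReal (u x ^ 2) ≤
        ENNReal.ofReal C *
          ∫⁻ x in (Ω : Set (E N)), ENNReal.ofReal (laplacianOfHessian H x ^ 2)

end Sobolev

section Radial

variable {N : ℕ}

/-- `g` is radial on `Ω`: its values depend on `|x|` only. -/
def IsRadial (Ω : Opens (E N)) (g : E N → ℝ≥0∞) : Prop :=
  ∀ x ∈ Ω, ∀ y ∈ Ω, ‖x‖ = ‖y‖ → g x = g y

/-- `g` is radially decreasing on `Ω` (in the wide sense). -/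
def IsRadiallyDecreasing (Ω : Opens (E N)) (g : E N → ℝ≥0∞) : Prop :=
  ∀ x ∈ Ω, ∀ y ∈ Ω, ‖x‖ ≤ ‖y‖ → g y ≤ g x

end Radial

end HardyRellich

/-! In dimension four `H²₀` just misses `L^∞`, and the failure is logarithmic; the weights that
compensate for it are those whose mass on small sets decays like the reciprocal of a logarithm.

Sufficiency. Integrating along rays shows that a test function `φ` is dominated by the potential of
`|D²φ|` with kernel `|x - y|⁻²`, and integration by parts gives `‖D²φ‖₂ = ‖Δφ‖₂`. The kernel is only
of weak type `L²`: its integral over `A` is at most `c |A|^{1/2}` (`setLIntegral_rieszKernel_le`).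
By Hardy–Littlewood, `g ∈ 𝓜 log L` gives `∫_A g ≤ M / (n + 1)` whenever `|A| ≤ |Ω| / 4ⁿ`. The core
is the trace inequality `lintegral_mul_sq_potential_le`. Cut `f = |D²φ|` at levels proportional to
`2ⁿ`. The potential of the part below level `n` is bounded by a constant plus a partial sum `Bₙ` of
numbers `bᵢ` with `∑ bᵢ² ≲ ‖f‖₂²`. The potential of the part above it is harmless off a set `Aₙ` of
measure at most `|Ω| / 4ⁿ`. Writing `B²` as a sum of increments `bₙ Bₙ₊₁` carried by `Aₙ`, where `g`
has mass at most `M / (n + 1)`, leaves `∑ bₙ Bₙ₊₁ / (n + 1)`, which the discrete Hardy inequality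
bounds by `2 ∑ bₙ²`. Density and Fatou's lemma extend the estimate to `H²₀`.

Necessity. Smooth logarithmic cutoffs equal to `1` on `B_r` and vanishing near `∂B_R` satisfy `∫
|Δφ|² ≲ 1 / log (R / r)`, so admissibility forces `∫_{B_r} g ≲ 1 / log (R / r)`. For a radially
decreasing `g` the centered ball of measure `t` carries at least the mass `∫₀ᵗ g^*`, which turns
this decay into the `𝓜 log L` bound. -/

namespace HardyRellich

/-! ### Discrete Hardy inequality -/

/-- A finite form of Hardy's inequality `∑ bₖ Bₖ₊₁ / (k + 1) ≤ 2 ∑ bₖ²`, where `B` denotes the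
partial sums of `b`. -/
theorem sum_mul_partialSum_div_le (b : ℕ → ℝ) (n : ℕ) :
    ∑ k ∈ Finset.range n, b k * (∑ i ∈ Finset.range (k + 1), b i) / (k + 1) ≤
      2 * ∑ k ∈ Finset.range n, b k ^ 2 := by
  -- The extra term `Sₙ² / (2n)` makes the inequality inductive: its increment leaves a sum of
  -- squares in each step.
  suffices h : ∑ k ∈ Finset.range n, b k * (∑ i ∈ Finset.range (k + 1), b i) / (k + 1) +
      (∑ i ∈ Finset.range n, b i) ^ 2 / (2 * n) ≤ 2 * ∑ k ∈ Finset.range n, b k ^ 2 by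
    have : 0 ≤ (∑ i ∈ Finset.range n, b i) ^ 2 / (2 * (n : ℝ)) := by positivity
    linarith
  induction n with
  | zero => simp
  | succ n ih =>
    rw [Finset.sum_range_succ, Finset.sum_range_succ (fun k ↦ b k ^ 2), mul_add]
    rw [Finset.sum_range_succ b n]
    have h0 : n = 0 → ∑ i ∈ Finset.range n, b i = 0 := by rintro rfl; simp
    generalize (∑ i ∈ Finset.range n, b i) = s at *
    suffices b n * (s + b n) / (n + 1) + (s + b n) ^ 2 / (2 * (n + 1 : ℕ)) ≤
      s ^ 2 / (2 * n) + 2 * b n ^ 2 by linarith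
    generalize b n = t
    push_cast
    -- For `n = 0` the term `s² / (2n)` is zero by the convention for division, so `s = 0` has to be
    -- supplied by `h0`.
    rcases Nat.eq_zero_or_pos n with rfl | hn
    · rw [h0 rfl]
      norm_num
      nlinarith [sq_nonneg t]
    · have hx : (0 : ℝ) < n := by exact_mod_cast hn
      generalize (n : ℝ) = x at *
      rw [← sub_nonneg]
      have : s ^ 2 / (2 * x) + 2 * t ^ 2 - (t * (s + t) / (x + 1) + (s + t) ^ 2 / (2 * (x + 1))) =
        ((2 * x * t - s) ^ 2 + x * t ^ 2) / (2 * x * (x + 1)) := by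
        field_simp
        ring
      rw [this]
      positivity

theorem ennreal_sum_mul_partialSum_div_le (b : ℕ → ℝ≥0∞) (n : ℕ) :
    ∑ k ∈ Finset.range n, b k * (∑ i ∈ Finset.range (k + 1), b i) / (k + 1) ≤
      2 * ∑ k ∈ Finset.range n, b k ^ 2 := by
  by_cases h : ∃ k < n, b k = ∞
  · obtain ⟨k, hk, hb⟩ := h
    have : ∑ k ∈ Finset.range n, b k ^ 2 = ∞ :=
      ENNReal.sum_eq_top.2 ⟨k, Finset.mem_range.2 hk, by simp [hb]⟩
    simp [this]
  · push Not at h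
    set β : ℕ → ℝ := fun k ↦ (b k).toReal with hβ
    have hb : ∀ k < n, b k = ENNReal.ofReal (β k) := fun k hk ↦ (ENNReal.ofReal_toReal (h k hk)).symm
    have hβ0 : ∀ k, 0 ≤ β k := fun k ↦ ENNReal.toReal_nonneg
    have h1 : ∑ k ∈ Finset.range n, b k * (∑ i ∈ Finset.range (k + 1), b i) / (k + 1) =
        ENNReal.ofReal (∑ k ∈ Finset.range n,
          β k * (∑ i ∈ Finset.range (k + 1), β i) / (k + 1)) := by
      rw [ENNReal.ofReal_sum_of_nonneg]
      · refine Finset.sum_congr rfl fun k hk ↦ ?_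
        have hk := Finset.mem_range.1 hk
        rw [ENNReal.ofReal_div_of_pos (by positivity), ENNReal.ofReal_mul (hβ0 k),
          ENNReal.ofReal_sum_of_nonneg (fun i _ ↦ hβ0 i), ← hb k hk]
        congr 1
        · congr 1
          refine Finset.sum_congr rfl fun i hi ↦ hb i ?_
          have := Finset.mem_range.1 hi
          omega
        · rw [ENNReal.ofReal_add (by positivity) zero_le_one]
          simp
      · intro k _
        have := Finset.sum_nonneg (fun i (_ : i ∈ Finset.range (k + 1)) ↦ hβ0 i)
        have := hβ0 k
        positivity
    have h2 : ∑ k ∈ Finset.range n, b k ^ 2 =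
        ENNReal.ofReal (∑ k ∈ Finset.range n, β k ^ 2) := by
      rw [ENNReal.ofReal_sum_of_nonneg (fun i _ ↦ by positivity)]
      refine Finset.sum_congr rfl fun k hk ↦ ?_
      rw [ENNReal.ofReal_pow (hβ0 k), ← hb k (Finset.mem_range.1 hk)]
    rw [h1, h2, show (2 : ℝ≥0∞) = ENNReal.ofReal 2 by simp, ← ENNReal.ofReal_mul (by norm_num)]
    exact ENNReal.ofReal_le_ofReal (sum_mul_partialSum_div_le β n)

/-- Telescoping: the increment `(s + t)² - s² = 2 t (s + t) - t²` is at most `2 t (s + t)`. This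
replaces a squared partial sum with a random stopping index by a sum of terms, each of which can be
integrated separately. -/
theorem sq_partialSum_le (b : ℕ → ℝ≥0∞) (n : ℕ) :
    (∑ i ∈ Finset.range n, b i) ^ 2 ≤
      ∑ k ∈ Finset.range n, 2 * (b k * ∑ i ∈ Finset.range (k + 1), b i) := by
  induction n with
  | zero => simp
  | succ n ih =>
    rw [Finset.sum_range_succ (fun k ↦ 2 * (b k * ∑ i ∈ Finset.range (k + 1), b i))]
    refine le_trans ?_ (add_le_add ih le_rfl)
    rw [Finset.sum_range_succ]
    generalize (∑ i ∈ Finset.range n, b i) = s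
    generalize b n = t
    calc (s + t) ^ 2 ≤ (s + t) ^ 2 + t ^ 2 := le_self_add
      _ = s ^ 2 + 2 * (t * (s + t)) := by ring

theorem ennreal_add_sq_le (x y : ℝ≥0∞) : (x + y) ^ 2 ≤ 2 * x ^ 2 + 2 * y ^ 2 := by
  have := ENNReal.rpow_add_le_mul_rpow_add_rpow x y (p := 2) (by norm_num)
  norm_num at this
  rw [← mul_add]
  exact_mod_cast this

/-! ### Trace inequality for potentials of weak type `L²` -/

section Potential

variable {X : Type*} [MeasurableSpace X]

/-- The `L²` mass of `f` below the level `l n` dominates the sum over the lower level strips. -/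
theorem setLIntegral_sq_levels_le (m : Measure X) {f : X → ℝ≥0∞} (hf : Measurable f)
    (l : ℕ → ℝ≥0∞) (hl : Monotone l) (n : ℕ) :
    ∑ k ∈ Finset.range n, l k ^ 2 * m {y | l k < f y ∧ f y ≤ l (k + 1)} ≤
      ∫⁻ y in {y | f y ≤ l n}, f y ^ 2 ∂m := by
  induction n with
  | zero => simp
  | succ n ih =>
    have hE : MeasurableSet {y | l n < f y ∧ f y ≤ l (n + 1)} :=
      (measurableSet_lt measurable_const hf).inter (measurableSet_le hf measurable_const)
    rw [Finset.sum_range_succ]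
    calc _ ≤ ∫⁻ y in {y | f y ≤ l n}, f y ^ 2 ∂m +
          ∫⁻ y in {y | l n < f y ∧ f y ≤ l (n + 1)}, f y ^ 2 ∂m := by
          refine add_le_add ih ?_
          rw [← setLIntegral_const]
          exact setLIntegral_mono (hf.pow_const 2) fun y hy ↦ by
            have := hy.1.le
            gcongr
      _ = _ := by
          rw [← lintegral_union hE]
          · congr 2
            ext y
            have := hl n.le_succ
            simp only [mem_union, mem_ofPred_eq]
            constructor
            · rintro (h | h)
              · exact h.trans this
              · exact h.2
            · intro h
              rcases le_or_gt (f y) (l n) with h' | h'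
              · exact Or.inl h'
              · exact Or.inr ⟨h', h⟩
          · exact Set.disjoint_left.2 fun y hy hy' ↦ (not_lt.2 hy) hy'.1

variable (m : Measure X) (k : X → X → ℝ≥0∞) (c : ℝ≥0∞)

/-- The potential of `f` cut at the level `l n` is bounded by the partial sums of the `L²` sizes of
the level strips of `f`. -/
theorem setLIntegral_potential_le {f : X → ℝ≥0∞} (hf : Measurable f)
    (hkc : ∀ x A, MeasurableSet A → ∫⁻ y in A, k x y ∂m ≤ c * m A ^ (1 / 2 : ℝ))
    (l : ℕ → ℝ≥0∞) (hltop : ∀ n, l n ≠ ∞) (x : X) (n : ℕ) :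
    ∫⁻ y in {y | f y ≤ l n}, k x y * f y ∂m ≤ c * (l 0 * m univ ^ (1 / 2 : ℝ) +
      ∑ i ∈ Finset.range n, l (i + 1) * m {y | l i < f y ∧ f y ≤ l (i + 1)} ^ (1 / 2 : ℝ)) := by
  have key : ∀ (A : Set X) (r : ℝ≥0∞), r ≠ ∞ → MeasurableSet A → (∀ y ∈ A, f y ≤ r) →
      ∫⁻ y in A, k x y * f y ∂m ≤ c * (r * m A ^ (1 / 2 : ℝ)) := by
    intro A r hr hA hfA
    calc ∫⁻ y in A, k x y * f y ∂m ≤ ∫⁻ y in A, k x y * r ∂m :=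
          setLIntegral_mono' hA fun y hy ↦ by
            have := hfA y hy
            gcongr
      _ = (∫⁻ y in A, k x y ∂m) * r := lintegral_mul_const' _ _ hr
      _ ≤ (c * m A ^ (1 / 2 : ℝ)) * r := by gcongr; exact hkc x A hA
      _ = _ := by ring
  induction n with
  | zero =>
    refine (key _ (l 0) (hltop 0) (measurableSet_le hf measurable_const) fun y hy ↦ hy).trans ?_
    simp only [Finset.range_zero, Finset.sum_empty, add_zero]
    gcongr
    exact subset_univ _
  | succ n ih =>
    have hE : MeasurableSet {y | l n < f y ∧ f y ≤ l (n + 1)} :=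
      (measurableSet_lt measurable_const hf).inter (measurableSet_le hf measurable_const)
    rw [Finset.sum_range_succ, ← add_assoc, mul_add]
    have hsub : {y | f y ≤ l (n + 1)} ⊆
        {y | f y ≤ l n} ∪ {y | l n < f y ∧ f y ≤ l (n + 1)} := by
      intro y hy
      rcases le_or_gt (f y) (l n) with h' | h'
      · exact Or.inl h'
      · exact Or.inr ⟨h', hy⟩
    calc _ ≤ ∫⁻ y in {y | f y ≤ l n} ∪ {y | l n < f y ∧ f y ≤ l (n + 1)}, k x y * f y ∂m :=
          lintegral_mono_set hsub
      _ ≤ _ := lintegral_union_le _ _ _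
      _ ≤ _ := add_le_add ih (key _ _ (hltop _) hE fun y hy ↦ hy.2)

/-- The potential of the part of `f` above the level `l` exceeds `c ‖f‖₂` on a small set only. -/
theorem meas_tail_potential_le [SFinite m] (hk : Measurable (Function.uncurry k))
    (hsymm : ∀ x y, k x y = k y x)
    (hkc : ∀ x A, MeasurableSet A → ∫⁻ y in A, k x y ∂m ≤ c * m A ^ (1 / 2 : ℝ))
    (hc : c ≠ ∞) (hc0 : c ≠ 0) {f : X → ℝ≥0∞} (hf : Measurable f) {a l : ℝ≥0∞}
    (ha : ∫⁻ y, f y ^ 2 ∂m = a ^ 2) (ha0 : a ≠ 0) (hatop : a ≠ ∞)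
    {A : Set X} (hA : MeasurableSet A) (hAtop : m A ≠ ∞)
    (h : ∀ x ∈ A, c * a ≤ ∫⁻ y in {y | l < f y}, k x y * f y ∂m) :
    l ^ 2 * m A ≤ a ^ 2 := by
  by_cases hm0 : m A = 0
  · simp [hm0]
  set q := m A ^ (1 / 2 : ℝ) with hq
  have hq2 : m A = q ^ 2 := by
    rw [hq, ← ENNReal.rpow_natCast, ← ENNReal.rpow_mul]
    norm_num
  have hq0 : q ≠ 0 := by
    intro h0
    exact hm0 (by rw [hq2, h0]; simp)
  have hqtop : q ≠ ∞ := by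
    intro h0
    exact hAtop (by rw [hq2, h0]; simp)
  have hS : MeasurableSet {y | l < f y} := measurableSet_lt measurable_const hf
  -- Integrate the lower bound over `A` and exchange the integrals; by symmetry the kernel estimate
  -- then applies to the integral over `A`.
  have h1 : c * a * q ^ 2 ≤ c * q * ∫⁻ y in {y | l < f y}, f y ∂m := by
    calc c * a * q ^ 2 = ∫⁻ x in A, c * a ∂m := by rw [setLIntegral_const, hq2]
      _ ≤ ∫⁻ x in A, ∫⁻ y in {y | l < f y}, k x y * f y ∂m ∂m := setLIntegral_mono' hA h
      _ = ∫⁻ y in {y | l < f y}, ∫⁻ x in A, k x y * f y ∂m ∂m := by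
          refine lintegral_lintegral_swap ?_
          exact (hk.mul (hf.comp measurable_snd)).aemeasurable
      _ ≤ ∫⁻ y in {y | l < f y}, c * q * f y ∂m := by
          refine lintegral_mono fun y ↦ ?_
          have hm : Measurable fun x ↦ k x y := hk.comp (measurable_id.prodMk measurable_const)
          rw [lintegral_mul_const _ hm]
          gcongr
          simp_rw [hsymm _ y]
          exact hkc y A hA
      _ = _ := lintegral_const_mul _ hf
  -- Chebyshev: `l f ≤ f²` where `f > l`.
  have h2 : l * ∫⁻ y in {y | l < f y}, f y ∂m ≤ a ^ 2 := by
    rw [← ha, ← lintegral_const_mul _ hf]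
    refine (setLIntegral_mono' hS fun y hy ↦ ?_).trans (setLIntegral_le_lintegral _ _)
    have : l ≤ f y := le_of_lt hy
    rw [sq]
    gcongr
  have h3 : (c * a * q) * (l * q) ≤ (c * a * q) * a := by
    calc (c * a * q) * (l * q) = l * (c * a * q ^ 2) := by ring
      _ ≤ l * (c * q * ∫⁻ y in {y | l < f y}, f y ∂m) := by gcongr
      _ = c * q * (l * ∫⁻ y in {y | l < f y}, f y ∂m) := by ring
      _ ≤ c * q * a ^ 2 := by gcongr
      _ = _ := by ring
  have h4 : l * q ≤ a := by
    refine (ENNReal.mul_le_mul_iff_right ?_ ?_).1 h3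
    · simp [hc0, ha0, hq0]
    · exact ENNReal.mul_ne_top (ENNReal.mul_ne_top hc hatop) hqtop
  calc l ^ 2 * m A = (l * q) ^ 2 := by rw [hq2]; ring
    _ ≤ a ^ 2 := by gcongr

/-- A trace inequality for potentials: on a finite measure space of total mass `V`, a weight `g`
with `∫_A g ≤ M / (n + 1)` whenever `m A ≤ V / 4ⁿ` is admissible for a symmetric kernel of
weak type `L²`. -/
theorem lintegral_mul_sq_potential_le [IsFiniteMeasure m] (hk : Measurable (Function.uncurry k))
    (hsymm : ∀ x y, k x y = k y x)
    (hkc : ∀ x A, MeasurableSet A → ∫⁻ y in A, k x y ∂m ≤ c * m A ^ (1 / 2 : ℝ))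
    (hc : c ≠ ∞) (hc0 : c ≠ 0) {g : X → ℝ≥0∞} (hg : AEMeasurable g m) {M : ℝ≥0∞}
    (hgM : ∀ (n : ℕ) (A : Set X), MeasurableSet A → 4 ^ n * m A ≤ m univ →
      ∫⁻ x in A, g x ∂m ≤ M / (n + 1))
    {f : X → ℝ≥0∞} (hf : Measurable f) (hf2 : ∫⁻ y, f y ^ 2 ∂m ≠ ∞) :
    ∫⁻ x, g x * (∫⁻ y, k x y * f y ∂m) ^ 2 ∂m ≤ 40 * c ^ 2 * M * ∫⁻ y, f y ^ 2 ∂m := by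
  by_cases hm : m univ = 0
  · simp [Measure.measure_univ_eq_zero.1 hm]
  by_cases hf0 : ∫⁻ y, f y ^ 2 ∂m = 0
  · have h0 : f =ᵐ[m] 0 := by
      filter_upwards [(lintegral_eq_zero_iff (hf.pow_const 2)).1 hf0] with y hy
      simpa using hy
    have : ∀ x, ∫⁻ y, k x y * f y ∂m = 0 := by
      intro x
      rw [lintegral_congr_ae (g := fun _ ↦ 0), lintegral_zero]
      filter_upwards [h0] with y hy
      simp [hy]
    simp [this]
  have hroot : ∀ t : ℝ≥0∞, (t ^ (1 / 2 : ℝ)) ^ 2 = t := fun t ↦ by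
    rw [← ENNReal.rpow_natCast, ← ENNReal.rpow_mul]
    norm_num
  set a := (∫⁻ y, f y ^ 2 ∂m) ^ (1 / 2 : ℝ) with ha_def
  set w := (m univ) ^ (1 / 2 : ℝ) with hw_def
  have ha : ∫⁻ y, f y ^ 2 ∂m = a ^ 2 := (hroot _).symm
  have hw : m univ = w ^ 2 := (hroot _).symm
  have ha0 : a ≠ 0 := fun h ↦ hf0 (by rw [ha, h]; simp)
  have hatop : a ≠ ∞ := fun h ↦ hf2 (by rw [ha, h]; simp)
  have hw0 : w ≠ 0 := fun h ↦ hm (by rw [hw, h]; simp)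
  have hwtop : w ≠ ∞ := fun h ↦ measure_ne_top m univ (by rw [hw, h]; simp)
  -- The normalization `l 0 * w = a` makes the part of `f` below the lowest level contribute at most
  -- `c ‖f‖₂` to the potential.
  set l : ℕ → ℝ≥0∞ := fun n ↦ a * w⁻¹ * 2 ^ n with hl_def
  have hltop : ∀ n, l n ≠ ∞ := fun n ↦
    ENNReal.mul_ne_top (ENNReal.mul_ne_top hatop (ENNReal.inv_ne_top.2 hw0)) (by simp)
  have hlmono : Monotone l := fun i j hij ↦ by
    simp only [hl_def]
    gcongr
    norm_num
  have hl0w : l 0 * w = a := by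
    simp only [hl_def, pow_zero, mul_one]
    rw [mul_assoc, ENNReal.inv_mul_cancel hw0 hwtop, mul_one]
  -- Each strip is weighted by its upper level, twice its lower one; hence the factor `4` in `hbsq`.
  set b : ℕ → ℝ≥0∞ := fun i ↦ l (i + 1) * m {y | l i < f y ∧ f y ≤ l (i + 1)} ^ (1 / 2 : ℝ)
    with hb_def
  have hbsq : ∀ n, ∑ i ∈ Finset.range n, b i ^ 2 ≤ 4 * a ^ 2 := by
    intro n
    calc ∑ i ∈ Finset.range n, b i ^ 2
        = ∑ i ∈ Finset.range n, 4 * (l i ^ 2 * m {y | l i < f y ∧ f y ≤ l (i + 1)}) := by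
          refine Finset.sum_congr rfl fun i _ ↦ ?_
          simp only [hb_def, mul_pow, hroot]
          simp only [hl_def]
          ring
      _ = 4 * ∑ i ∈ Finset.range n, l i ^ 2 * m {y | l i < f y ∧ f y ≤ l (i + 1)} := by
          rw [Finset.mul_sum]
      _ ≤ 4 * ∫⁻ y in {y | f y ≤ l n}, f y ^ 2 ∂m := by
          gcongr
          exact setLIntegral_sq_levels_le m hf l hlmono n
      _ ≤ 4 * a ^ 2 := by
          rw [← ha]
          gcongr
          exact Measure.restrict_le_self
  set tail : ℕ → X → ℝ≥0∞ := fun n x ↦ ∫⁻ y in {y | l n < f y}, k x y * f y ∂m with htail_def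
  have htail_meas : ∀ n, Measurable (tail n) := fun n ↦
    Measurable.lintegral_prod_right' (f := fun p : X × X ↦ k p.1 p.2 * f p.2)
      (hk.mul (hf.comp measurable_snd))
  -- Off `A n` the tail costs no more than the lowest part, `c ‖f‖₂`; on `A n` a higher cut is
  -- needed.
  set A : ℕ → Set X := fun n ↦ {x | c * a ≤ tail n x} with hA_def
  have hA : ∀ n, MeasurableSet (A n) := fun n ↦ measurableSet_le measurable_const (htail_meas n)
  have hmA : ∀ n, 4 ^ n * m (A n) ≤ m univ := by
    intro n
    have h1 := meas_tail_potential_le m k c hk hsymm hkc hc hc0 hf ha ha0 hatop (hA n)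
      (measure_ne_top _ _) (fun x hx ↦ hx)
    have h2 : (a ^ 2) * (4 ^ n * m (A n)) ≤ a ^ 2 * w ^ 2 := by
      calc (a ^ 2) * (4 ^ n * m (A n)) = (l n ^ 2 * m (A n)) * w ^ 2 := by
            have : l n * w = a * 2 ^ n := by
              rw [← hl0w]
              simp only [hl_def]
              ring
            calc _ = (a * 2 ^ n) ^ 2 * m (A n) := by
                  rw [mul_pow, ← pow_mul, mul_comm n 2, pow_mul]
                  norm_num
                  ring
              _ = _ := by rw [← this]; ring
        _ ≤ a ^ 2 * w ^ 2 := by gcongr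
    rw [hw]
    exact (ENNReal.mul_le_mul_iff_right (by simp [ha0]) (by simp [hatop])).1 h2
  have hgA : ∀ n, ∫⁻ x in A n, g x ∂m ≤ M / (n + 1) := fun n ↦ hgM n (A n) (hA n) (hmA n)
  set B : ℕ → ℝ≥0∞ := fun n ↦ ∑ i ∈ Finset.range n, b i with hB_def
  have hpt : ∀ x n, x ∉ A n → ∫⁻ y, k x y * f y ∂m ≤ 2 * c * a + c * B n := by
    intro x n hx
    have hx : tail n x ≤ c * a := le_of_lt (not_le.1 hx)
    have h1 := setLIntegral_potential_le m k c hf hkc l hltop x n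
    rw [← hw_def, hl0w] at h1
    have h2 : ∫⁻ y, k x y * f y ∂m ≤ ∫⁻ y in {y | f y ≤ l n}, k x y * f y ∂m + tail n x := by
      rw [← setLIntegral_univ]
      refine (lintegral_mono_set ?_).trans (lintegral_union_le _ _ _)
      intro y _
      exact le_or_gt (f y) (l n)
    calc _ ≤ _ := h2
      _ ≤ c * (a + B n) + c * a := add_le_add h1 hx
      _ = _ := by ring
  -- Since `m (A n) ≤ m univ / 4ⁿ`, almost every point leaves some `A n`, and the pointwise bound is
  -- used at the first such index.
  have hnull : m (⋂ n, A n) = 0 := by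
    by_contra hne
    have hle : ∀ n : ℕ, (4 : ℝ≥0∞) ^ n * m (⋂ n, A n) ≤ m univ := fun n ↦
      le_trans (by gcongr; exact iInter_subset _ n) (hmA n)
    have ht : Tendsto (fun n : ℕ ↦ (4 : ℝ≥0∞) ^ n * m (⋂ n, A n)) atTop
        (𝓝 (∞ * m (⋂ n, A n))) :=
      ENNReal.Tendsto.mul_const (ENNReal.tendsto_pow_atTop_nhds_top_iff.2 (by norm_num))
        (Or.inr (measure_ne_top _ _))
    rw [ENNReal.top_mul hne] at ht
    exact measure_ne_top m univ (top_le_iff.1 (le_of_tendsto' ht hle))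
  have hae : ∀ᵐ x ∂m, g x * (∫⁻ y, k x y * f y ∂m) ^ 2 ≤
      8 * c ^ 2 * a ^ 2 * g x + ∑' n, 4 * c ^ 2 * (b n * B (n + 1)) * (A n).indicator g x := by
    have : ∀ᵐ x ∂m, x ∉ ⋂ n, A n := measure_eq_zero_iff_ae_notMem.1 hnull
    filter_upwards [this] with x hx
    simp only [mem_iInter, not_forall] at hx
    classical
    -- Minimality of `K` puts `x` in every `A n` with `n < K`, so each increment of `B K ^ 2` comes
    -- with the indicator of `A n`.
    set K := Nat.find hx
    have hK : x ∉ A K := Nat.find_spec hx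
    have hlt : ∀ n < K, x ∈ A n := fun n hn ↦ not_not.1 (Nat.find_min hx hn)
    calc g x * (∫⁻ y, k x y * f y ∂m) ^ 2 ≤ g x * (2 * c * a + c * B K) ^ 2 := by
          gcongr
          exact hpt x K hK
      _ ≤ g x * (2 * (2 * c * a) ^ 2 + 2 * (c * B K) ^ 2) := by
          gcongr
          exact ennreal_add_sq_le _ _
      _ = 8 * c ^ 2 * a ^ 2 * g x + 2 * c ^ 2 * g x * B K ^ 2 := by ring
      _ ≤ 8 * c ^ 2 * a ^ 2 * g x + 2 * c ^ 2 * g x *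
          ∑ n ∈ Finset.range K, 2 * (b n * B (n + 1)) := by
          gcongr
          exact sq_partialSum_le b K
      _ = 8 * c ^ 2 * a ^ 2 * g x + ∑ n ∈ Finset.range K,
          4 * c ^ 2 * (b n * B (n + 1)) * (A n).indicator g x := by
          rw [Finset.mul_sum]
          congr 1
          refine Finset.sum_congr rfl fun n hn ↦ ?_
          rw [indicator_of_mem (hlt n (Finset.mem_range.1 hn))]
          ring
      _ ≤ _ := by
          gcongr
          exact ENNReal.sum_le_tsum _
  have hgi : ∀ n, AEMeasurable ((A n).indicator g) m := fun n ↦ hg.indicator (hA n)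
  calc ∫⁻ x, g x * (∫⁻ y, k x y * f y ∂m) ^ 2 ∂m
      ≤ ∫⁻ x, (8 * c ^ 2 * a ^ 2 * g x +
          ∑' n, 4 * c ^ 2 * (b n * B (n + 1)) * (A n).indicator g x) ∂m := lintegral_mono_ae hae
    _ = 8 * c ^ 2 * a ^ 2 * ∫⁻ x, g x ∂m +
          ∑' n, 4 * c ^ 2 * (b n * B (n + 1)) * ∫⁻ x in A n, g x ∂m := by
        rw [lintegral_add_left' (hg.const_mul _), lintegral_const_mul'' _ hg,
          lintegral_tsum fun n ↦ (hgi n).const_mul _]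
        congr 1
        refine tsum_congr fun n ↦ ?_
        rw [lintegral_const_mul'' _ (hgi n), lintegral_indicator (hA n)]
    -- `32 = 4 · 2 · 4`: the coefficient of the increments, the Hardy constant and the factor in
    -- `hbsq`.
    _ ≤ 8 * c ^ 2 * a ^ 2 * M + 32 * c ^ 2 * M * a ^ 2 := by
        refine add_le_add ?_ ?_
        · gcongr
          simpa using hgM 0 univ MeasurableSet.univ (by simp)
        · rw [ENNReal.tsum_eq_iSup_nat]
          refine iSup_le fun n ↦ ?_
          calc ∑ i ∈ Finset.range n, 4 * c ^ 2 * (b i * B (i + 1)) * ∫⁻ x in A i, g x ∂m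
              ≤ ∑ i ∈ Finset.range n, 4 * c ^ 2 * M * (b i * B (i + 1) / (i + 1)) := by
                refine Finset.sum_le_sum fun i _ ↦ ?_
                calc _ ≤ 4 * c ^ 2 * (b i * B (i + 1)) * (M / (i + 1)) := by
                      gcongr
                      exact hgA i
                  _ = _ := by
                      simp only [div_eq_mul_inv]
                      ring
            _ = 4 * c ^ 2 * M * ∑ i ∈ Finset.range n, b i * B (i + 1) / (i + 1) := by
                rw [Finset.mul_sum]
            _ ≤ 4 * c ^ 2 * M * (2 * ∑ i ∈ Finset.range n, b i ^ 2) := by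
                gcongr
                exact ennreal_sum_mul_partialSum_div_le b n
            _ ≤ 4 * c ^ 2 * M * (2 * (4 * a ^ 2)) := by
                gcongr
                exact hbsq n
            _ = _ := by ring
    _ = 40 * c ^ 2 * M * ∫⁻ y, f y ^ 2 ∂m := by
        rw [ha]
        ring

end Potential
-- Layer cake formulas with values in `[0, ∞]`
section LayerCake

theorem volume_setOf_pos_ofReal_lt (c : ℝ≥0∞) :
    volume {s : ℝ | 0 < s ∧ ENNReal.ofReal s < c} = c := by
  induction c with
  | top =>
    have : {s : ℝ | 0 < s ∧ ENNReal.ofReal s < ∞} = Ioi 0 := by ext; simp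
    rw [this, Real.volume_Ioi]
  | coe c =>
    have : {s : ℝ | 0 < s ∧ ENNReal.ofReal s < c} = Ioo 0 (c : ℝ) := by
      ext s
      simp only [mem_ofPred_eq, mem_Ioo, and_congr_right_iff]
      intro hs
      rw [ENNReal.ofReal_lt_coe_iff hs.le]
    rw [this, Real.volume_Ioo]
    simp

theorem volume_setOf_pos_ofReal_le (c : ℝ≥0∞) :
    volume {s : ℝ | 0 < s ∧ ENNReal.ofReal s ≤ c} = c := by
  induction c with
  | top =>
    have : {s : ℝ | 0 < s ∧ ENNReal.ofReal s ≤ ∞} = Ioi 0 := by ext; simp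
    rw [this, Real.volume_Ioi]
  | coe c =>
    have : {s : ℝ | 0 < s ∧ ENNReal.ofReal s ≤ c} = Ioc 0 (c : ℝ) := by
      ext s
      simp only [mem_ofPred_eq, mem_Ioc, and_congr_right_iff]
      intro hs
      rw [← ENNReal.ofReal_coe_nnreal]
      exact ENNReal.ofReal_le_ofReal_iff c.2
    rw [this, Real.volume_Ioc]
    simp

variable {X : Type*} [MeasurableSpace X] {m : Measure X} [SFinite m] {f : X → ℝ≥0∞}

/-- The layer cake formula for extended nonnegative functions, with strict superlevel sets. -/
theorem lintegral_eq_lintegral_meas_ofReal_lt (hf : AEMeasurable f m) :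
    ∫⁻ x, f x ∂m = ∫⁻ s in Ioi (0 : ℝ), m {x | ENNReal.ofReal s < f x} := by
  wlog hf' : Measurable f generalizing f
  · rw [lintegral_congr_ae hf.ae_eq_mk, this hf.measurable_mk.aemeasurable hf.measurable_mk]
    refine lintegral_congr fun s ↦ measure_congr ?_
    filter_upwards [hf.ae_eq_mk] with x hx
    simp only [eq_iff_iff]
    change _ < _ ↔ _ < _
    rw [hx]
  have hS : MeasurableSet {p : X × ℝ | 0 < p.2 ∧ ENNReal.ofReal p.2 < f p.1} :=
    (measurableSet_lt measurable_const measurable_snd).inter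
      (measurableSet_lt (ENNReal.measurable_ofReal.comp measurable_snd) (hf'.comp measurable_fst))
  have h := Measure.prod_apply (μ := m) (ν := (volume : Measure ℝ)) hS
  have h' := Measure.prod_apply_symm (μ := m) (ν := (volume : Measure ℝ)) hS
  have e1 : ∀ x, volume (Prod.mk x ⁻¹' {p : X × ℝ | 0 < p.2 ∧ ENNReal.ofReal p.2 < f p.1}) = f x :=
    fun x ↦ volume_setOf_pos_ofReal_lt (f x)
  simp_rw [e1] at h
  rw [← h, h', ← lintegral_indicator measurableSet_Ioi]
  refine lintegral_congr fun s ↦ ?_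
  by_cases hs : 0 < s
  · rw [indicator_of_mem (mem_Ioi.2 hs)]
    congr 1
    ext x
    simp [hs]
  · rw [indicator_of_notMem (by simpa using hs)]
    simp [hs]

/-- The layer cake formula for extended nonnegative functions, with wide superlevel sets. -/
theorem lintegral_eq_lintegral_meas_ofReal_le (hf : Measurable f) :
    ∫⁻ x, f x ∂m = ∫⁻ s in Ioi (0 : ℝ), m {x | ENNReal.ofReal s ≤ f x} := by
  have hS : MeasurableSet {p : X × ℝ | 0 < p.2 ∧ ENNReal.ofReal p.2 ≤ f p.1} :=
    (measurableSet_lt measurable_const measurable_snd).inter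
      (measurableSet_le (ENNReal.measurable_ofReal.comp measurable_snd) (hf.comp measurable_fst))
  have h := Measure.prod_apply (μ := m) (ν := (volume : Measure ℝ)) hS
  have h' := Measure.prod_apply_symm (μ := m) (ν := (volume : Measure ℝ)) hS
  have e1 : ∀ x, volume (Prod.mk x ⁻¹' {p : X × ℝ | 0 < p.2 ∧ ENNReal.ofReal p.2 ≤ f p.1}) = f x :=
    fun x ↦ volume_setOf_pos_ofReal_le (f x)
  simp_rw [e1] at h
  rw [← h, h', ← lintegral_indicator measurableSet_Ioi]
  refine lintegral_congr fun s ↦ ?_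
  by_cases hs : 0 < s
  · rw [indicator_of_mem (mem_Ioi.2 hs)]
    congr 1
    ext x
    simp [hs]
  · rw [indicator_of_notMem (by simpa using hs)]
    simp [hs]

end LayerCake

/-! ### Decreasing rearrangement and Hardy–Littlewood -/

section Rearrangement

variable {N : ℕ} {Ω : Opens (E N)} {g : E N → ℝ≥0∞}

theorem distribution_antitone : Antitone (distribution Ω g) := fun _ _ h ↦
  measure_mono fun _ hx ↦ ⟨hx.1, h.trans_lt hx.2⟩

theorem rearrangement_antitone : Antitone (rearrangement Ω g) := fun _ _ h ↦
  sInf_le_sInf fun _ hs ↦ ⟨hs.1, hs.2.trans_le (ENNReal.ofReal_le_ofReal h)⟩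

theorem measurable_rearrangement : Measurable (rearrangement Ω g) :=
  rearrangement_antitone.measurable

theorem rearrangement_le_of_distribution_lt {s : ℝ≥0∞} {τ : ℝ} (hs : 0 < s)
    (h : distribution Ω g s < ENNReal.ofReal τ) : rearrangement Ω g τ ≤ s :=
  sInf_le ⟨hs, h⟩

theorem le_rearrangement_of_le_distribution {s : ℝ≥0∞} {τ : ℝ}
    (h : ENNReal.ofReal τ ≤ distribution Ω g s) : s ≤ rearrangement Ω g τ :=
  le_sInf fun s' hs' ↦ by
    by_contra! hlt
    exact absurd (hs'.2.trans_le h) (not_lt.2 (distribution_antitone hlt.le))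

/-- `∫₀ᵗ g^* = ∫₀^∞ min (t, α_g(s)) ds`. -/
theorem lintegral_rearrangement_eq (t : ℝ) :
    ∫⁻ τ in Ioo 0 t, rearrangement Ω g τ =
      ∫⁻ s in Ioi (0 : ℝ), min (ENNReal.ofReal t) (distribution Ω g (ENNReal.ofReal s)) := by
  apply le_antisymm
  · rw [lintegral_eq_lintegral_meas_ofReal_lt measurable_rearrangement.aemeasurable]
    refine setLIntegral_mono' measurableSet_Ioi fun s hs ↦ ?_
    refine le_min ((measure_mono (subset_univ _)).trans (by simp)) ?_
    rw [Measure.restrict_apply (measurableSet_lt measurable_const measurable_rearrangement)]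
    generalize hd : distribution Ω g (ENNReal.ofReal s) = d
    have hsub : {τ | ENNReal.ofReal s < rearrangement Ω g τ} ∩ Ioo 0 t ⊆
        {τ | 0 < τ ∧ ENNReal.ofReal τ ≤ d} := by
      rintro τ ⟨hτ, h0, _⟩
      refine ⟨h0, ?_⟩
      by_contra! hlt
      rw [← hd] at hlt
      exact absurd hτ (not_lt.2 (rearrangement_le_of_distribution_lt (by simpa using hs) hlt))
    exact (measure_mono hsub).trans (volume_setOf_pos_ofReal_le d).le
  · rw [lintegral_eq_lintegral_meas_ofReal_le measurable_rearrangement]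
    refine setLIntegral_mono' measurableSet_Ioi fun s hs ↦ ?_
    rw [Measure.restrict_apply (measurableSet_le measurable_const measurable_rearrangement)]
    generalize hd : distribution Ω g (ENNReal.ofReal s) = d
    have hsub : {τ | 0 < τ ∧ ENNReal.ofReal τ < min (ENNReal.ofReal t) d} ⊆
        {τ | ENNReal.ofReal s ≤ rearrangement Ω g τ} ∩ Ioo 0 t := by
      rintro τ ⟨h0, hτ⟩
      have h1 := hτ.trans_le (min_le_left _ _)
      have h2 := hτ.trans_le (min_le_right _ _)
      rw [← hd] at h2
      exact ⟨le_rearrangement_of_le_distribution h2.le, h0, (ENNReal.ofReal_lt_ofReal_iff'.1 h1).1⟩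
    exact (volume_setOf_pos_ofReal_lt _).symm.le.trans (measure_mono hsub)

/-- Hardy–Littlewood: `∫_A g ≤ ∫₀ᵗ g^*` if `|A| ≤ t`. -/
theorem setLIntegral_le_lintegral_rearrangement
    (hg : AEMeasurable g (volume.restrict (Ω : Set (E N)))) {A : Set (E N)} {t : ℝ}
    (hAt : volume.restrict (Ω : Set (E N)) A ≤ ENNReal.ofReal t) :
    ∫⁻ x in A, g x ∂(volume.restrict (Ω : Set (E N))) ≤ ∫⁻ τ in Ioo 0 t, rearrangement Ω g τ := by
  rw [lintegral_rearrangement_eq, lintegral_eq_lintegral_meas_ofReal_lt hg.restrict]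
  refine lintegral_mono fun s ↦ le_min ((measure_mono (subset_univ _)).trans (by simpa using hAt)) ?_
  refine (Measure.restrict_apply_le _ _).trans ?_
  have hn : NullMeasurableSet {x | ENNReal.ofReal s < g x} (volume.restrict (Ω : Set (E N))) :=
    nullMeasurableSet_lt aemeasurable_const hg
  rw [Measure.restrict_apply₀ hn, distribution]
  exact measure_mono fun x hx ↦ ⟨hx.2, hx.1⟩

/-- By the formula with `min (t, α_g)`, a fourfold `t` costs at most a factor `4`. This reaches `t =
|Ω|`, where the logarithm vanishes and the norm gives no information. -/
theorem lintegral_rearrangement_four_mul_le (t : ℝ) :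
    ∫⁻ τ in Ioo 0 (4 * t), rearrangement Ω g τ ≤ 4 * ∫⁻ τ in Ioo 0 t, rearrangement Ω g τ := by
  rw [lintegral_rearrangement_eq, lintegral_rearrangement_eq,
    ← lintegral_const_mul' _ _ (by norm_num)]
  refine lintegral_mono fun s ↦ ?_
  rw [ENNReal.ofReal_mul (by norm_num)]
  rw [show ENNReal.ofReal 4 = 4 by simp, mul_min_of_nonneg _ _ (by simp)]
  exact min_le_min le_rfl (le_mul_of_one_le_left (by simp) (by norm_num))

theorem ofReal_mul_maximalRearrangement {t : ℝ} (ht : 0 < t) (a : ℝ) :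
    ENNReal.ofReal (t * a) * maximalRearrangement Ω g t =
      ENNReal.ofReal a * ∫⁻ τ in Ioo 0 t, rearrangement Ω g τ := by
  rw [maximalRearrangement, ENNReal.ofReal_mul ht.le]
  have : ENNReal.ofReal t * (ENNReal.ofReal t)⁻¹ = 1 :=
    ENNReal.mul_inv_cancel (by simpa using ht) (by simp)
  calc _ = (ENNReal.ofReal t * (ENNReal.ofReal t)⁻¹) * (ENNReal.ofReal a *
      ∫⁻ τ in Ioo 0 t, rearrangement Ω g τ) := by ring
    _ = _ := by rw [this, one_mul]

/-- A bound on `∫₀ᵗ g^*` in terms of the `𝓜 log L` norm. -/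
theorem lintegral_rearrangement_le_of_mLogLNorm {t : ℝ} (ht : 0 < t)
    (htV : t < volume.real (Ω : Set (E N))) :
    ENNReal.ofReal (Real.log (volume.real (Ω : Set (E N)) / t)) *
      ∫⁻ τ in Ioo 0 t, rearrangement Ω g τ ≤ mLogLNorm Ω g :=
  (ofReal_mul_maximalRearrangement ht _).symm.le.trans (le_iSup₂_of_le t ⟨ht, htV⟩ le_rfl)

/-- The quantitative smallness of `∫_A g` needed for the trace inequality. -/
theorem setLIntegral_le_of_mLogLNorm (hΩ : volume (Ω : Set (E N)) ≠ ∞)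
    (hg : AEMeasurable g (volume.restrict (Ω : Set (E N)))) (n : ℕ) {A : Set (E N)}
    (hAn : 4 ^ n * volume.restrict (Ω : Set (E N)) A ≤ volume.restrict (Ω : Set (E N)) univ) :
    ∫⁻ x in A, g x ∂(volume.restrict (Ω : Set (E N))) ≤ 4 * mLogLNorm Ω g / (n + 1) := by
  set V := volume.real (Ω : Set (E N)) with hV
  have hVeq : volume (Ω : Set (E N)) = ENNReal.ofReal V := by
    rw [hV, Measure.real, ENNReal.ofReal_toReal hΩ]
  rcases (measureReal_nonneg : 0 ≤ volume.real (Ω : Set (E N))).eq_or_lt with h0 | h0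
  · have : volume (Ω : Set (E N)) = 0 := by rw [hVeq, hV, ← h0]; simp
    have : volume.restrict (Ω : Set (E N)) = 0 := by simpa using this
    simp [this]
  change 0 < V at h0
  rw [Measure.restrict_apply_univ, hVeq] at hAn
  have hAn' : volume.restrict (Ω : Set (E N)) A ≤ ENNReal.ofReal (V / 4 ^ n) := by
    rw [ENNReal.ofReal_div_of_pos (by positivity), ENNReal.le_div_iff_mul_le (by simp) (by simp),
      mul_comm]
    simpa [ENNReal.ofReal_pow] using hAn
  have hlog : ∀ j : ℕ, ENNReal.ofReal (Real.log (V / (V / 4 ^ (j + 1)))) ≥ j + 1 := by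
    intro j
    have : V / (V / 4 ^ (j + 1)) = 4 ^ (j + 1) := by
      field_simp
    rw [this, Real.log_pow]
    have h4 : 1 ≤ Real.log 4 := by
      rw [Real.le_log_iff_exp_le (by norm_num)]
      linarith [Real.exp_one_lt_d9]
    calc (j + 1 : ℝ≥0∞) = ENNReal.ofReal ((j + 1 : ℕ) * 1) := by
          rw [mul_one, ENNReal.ofReal_natCast]
          simp
      _ ≤ _ := by gcongr
  have hmain : ∀ j : ℕ, ∫⁻ τ in Ioo 0 (V / 4 ^ (j + 1)), rearrangement Ω g τ ≤
      mLogLNorm Ω g / (j + 1) := by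
    intro j
    have := lintegral_rearrangement_le_of_mLogLNorm (Ω := Ω) (g := g) (t := V / 4 ^ (j + 1))
      (by positivity) (div_lt_self h0 (one_lt_pow₀ (by norm_num) (by simp)))
    rw [ENNReal.le_div_iff_mul_le (by simp) (by simp), mul_comm]
    refine le_trans ?_ this
    gcongr
    exact hlog j
  refine (setLIntegral_le_lintegral_rearrangement hg hAn').trans ?_
  -- For `n = 0` pass from `V` to `V / 4` by the fourfold bound. For a successor, `1 / (n + 1) ≤ 4 /
  -- (n + 2)` absorbs the shift of index.
  cases n with
  | zero =>
    have := lintegral_rearrangement_four_mul_le (Ω := Ω) (g := g) (V / 4)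
    rw [show 4 * (V / 4) = V / 4 ^ 0 by ring] at this
    refine this.trans ?_
    have := hmain 0
    simp only [zero_add, pow_one, Nat.cast_zero, div_one] at this
    simp only [Nat.cast_zero, zero_add, div_one]
    gcongr
  | succ n =>
    refine (hmain n).trans ?_
    rw [← ENNReal.mul_div_mul_left (mLogLNorm Ω g) ((n : ℝ≥0∞) + 1) (c := 4) (by simp) (by simp)]
    refine ENNReal.div_le_div_left ?_ _
    exact_mod_cast (by omega : n + 1 + 1 ≤ 4 * (n + 1))

end Rearrangement
-- Partial derivatives and the `L²` identity between Hessian and Laplacian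
section PartialDeriv

variable {N : ℕ} {f : E N → ℝ}

theorem contDiff_partialDeriv (hf : ContDiff ℝ (⊤ : ℕ∞) f) (i : Fin N) :
    ContDiff ℝ (⊤ : ℕ∞) (partialDeriv i f) :=
  (hf.fderiv_right (m := (⊤ : ℕ∞)) le_rfl).clm_apply contDiff_const

theorem tsupport_partialDeriv_subset (f : E N → ℝ) (i : Fin N) :
    tsupport (partialDeriv i f) ⊆ tsupport f :=
  tsupport_fderiv_apply_subset ℝ _

theorem hasCompactSupport_partialDeriv (hf : HasCompactSupport f) (i : Fin N) :
    HasCompactSupport (partialDeriv i f) :=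
  hf.fderiv_apply ℝ _

theorem fderiv_apply_eq_sum_partialDeriv (f : E N → ℝ) (x z : E N) :
    fderiv ℝ f x z = ∑ i, z i * partialDeriv i f x := by
  have hz : z = ∑ i, z i • EuclideanSpace.single i (1 : ℝ) := by
    have := (EuclideanSpace.basisFun (Fin N) ℝ).sum_repr z
    simpa using this.symm
  conv_lhs => rw [hz]
  simp [partialDeriv]

theorem partialDeriv_comm (hf : ContDiff ℝ (⊤ : ℕ∞) f) (i j : Fin N) :
    partialDeriv i (partialDeriv j f) = partialDeriv j (partialDeriv i f) := by
  have hd : Differentiable ℝ (fderiv ℝ f) :=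
    (hf.fderiv_right (m := (⊤ : ℕ∞)) le_rfl).differentiable (by simp)
  have key : ∀ (i j : Fin N) (x : E N), partialDeriv i (partialDeriv j f) x =
      fderiv ℝ (fderiv ℝ f) x (EuclideanSpace.single i 1) (EuclideanSpace.single j 1) := by
    intro i j x
    change fderiv ℝ (fun y ↦ fderiv ℝ f y (EuclideanSpace.single j 1)) x _ = _
    rw [fderiv_clm_apply (hd x) (differentiableAt_const _)]
    simp
  ext x
  rw [key, key]
  have hs : IsSymmSndFDerivAt ℝ f x :=
    (hf.contDiffAt (x := x)).isSymmSndFDerivAt (by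
      rw [minSmoothness_of_isRCLikeNormedField]
      exact (WithTop.coe_le_coe.2 le_top : ((2 : ℕ∞) : WithTop ℕ∞) ≤ ((⊤ : ℕ∞) : WithTop ℕ∞)))
  exact hs.eq _ _

theorem integral_mul_partialDeriv {f g : E N → ℝ} (hf : ContDiff ℝ (⊤ : ℕ∞) f)
    (hg : ContDiff ℝ (⊤ : ℕ∞) g) (hg' : HasCompactSupport g) (i : Fin N) :
    ∫ x, f x * partialDeriv i g x = - ∫ x, partialDeriv i f x * g x := by
  refine integral_mul_fderiv_eq_neg_fderiv_mul_of_integrable ?_ ?_ ?_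
    (fun x _ ↦ hf.differentiable (by simp) x) (fun x _ ↦ hg.differentiable (by simp) x)
  · exact ((contDiff_partialDeriv hf i).continuous.mul hg.continuous).integrable_of_hasCompactSupport
      hg'.mul_left
  · exact (hf.continuous.mul (contDiff_partialDeriv hg i).continuous).integrable_of_hasCompactSupport
      (hasCompactSupport_partialDeriv hg' i).mul_left
  · exact (hf.continuous.mul hg.continuous).integrable_of_hasCompactSupport hg'.mul_left

/-- `∫ |D²f|² = ∫ |Δf|²` for `f ∈ C_c^∞`. -/
theorem integral_sum_sq_hessian_eq (hf : ContDiff ℝ (⊤ : ℕ∞) f) (hf' : HasCompactSupport f) :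
    ∫ x, ∑ i, ∑ j, partialDeriv j (partialDeriv i f) x ^ 2 =
      ∫ x, (∑ i, partialDeriv i (partialDeriv i f) x) ^ 2 := by
  have hd := fun i ↦ contDiff_partialDeriv hf i
  have hdd := fun i j ↦ contDiff_partialDeriv (hd i) j
  have hc := fun i ↦ hasCompactSupport_partialDeriv hf' i
  have hcc := fun i j ↦ hasCompactSupport_partialDeriv (hc i) j
  -- Integrating by parts once, in `x_j` on the left and in `x_i` on the right, turns both sides
  -- into minus the integral of `∂ᵢ f` times the same third derivative.
  have key : ∀ i j, ∫ x, partialDeriv j (partialDeriv i f) x ^ 2 =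
      ∫ x, partialDeriv i (partialDeriv i f) x * partialDeriv j (partialDeriv j f) x := by
    intro i j
    have h1 := integral_mul_partialDeriv (hdd i j) (hd i) (hc i) j
    have h2 := integral_mul_partialDeriv (hdd j j) (hd i) (hc i) i
    have h3 : partialDeriv j (partialDeriv j (partialDeriv i f)) =
        partialDeriv i (partialDeriv j (partialDeriv j f)) := by
      rw [partialDeriv_comm hf j i, partialDeriv_comm (hd j) j i]
    rw [h3, ← h2] at h1
    simp_rw [sq, h1]
    exact integral_congr_ae (Eventually.of_forall fun x ↦ mul_comm _ _)
  have hint : ∀ i j k l, Integrable fun x ↦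
      partialDeriv j (partialDeriv i f) x * partialDeriv l (partialDeriv k f) x :=
    fun i j k l ↦ ((hdd i j).continuous.mul (hdd k l).continuous).integrable_of_hasCompactSupport
      (hcc k l).mul_left
  have hint2 : ∀ i j, Integrable fun x ↦ partialDeriv j (partialDeriv i f) x ^ 2 := fun i j ↦ by
    simpa [sq] using hint i j i j
  rw [integral_finsetSum _ fun i _ ↦ integrable_finsetSum _ fun j _ ↦ hint2 i j]
  simp_rw [sq (∑ i, partialDeriv i (partialDeriv i f) _), Finset.sum_mul_sum]
  rw [integral_finsetSum _ fun i _ ↦ integrable_finsetSum _ fun j _ ↦ hint i i j j]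
  refine Finset.sum_congr rfl fun i _ ↦ ?_
  rw [integral_finsetSum _ fun j _ ↦ hint2 i j, integral_finsetSum _ fun j _ ↦ hint i i j j]
  exact Finset.sum_congr rfl fun j _ ↦ key i j

/-- The `ℓ¹` norm of the Hessian. -/
noncomputable def hessianNorm (f : E N → ℝ) (x : E N) : ℝ :=
  ∑ i, ∑ j, |partialDeriv j (partialDeriv i f) x|

theorem hessianNorm_nonneg (f : E N → ℝ) (x : E N) : 0 ≤ hessianNorm f x :=
  Finset.sum_nonneg fun _ _ ↦ Finset.sum_nonneg fun _ _ ↦ abs_nonneg _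

theorem continuous_hessianNorm (hf : ContDiff ℝ (⊤ : ℕ∞) f) : Continuous (hessianNorm f) :=
  continuous_finsetSum _ fun i _ ↦ continuous_finsetSum _ fun j _ ↦
    (contDiff_partialDeriv (contDiff_partialDeriv hf i) j).continuous.abs

theorem hessianNorm_eq_zero_of_notMem_tsupport {x : E N} (hx : x ∉ tsupport f) :
    hessianNorm f x = 0 := by
  refine Finset.sum_eq_zero fun i _ ↦ Finset.sum_eq_zero fun j _ ↦ ?_
  rw [abs_eq_zero]
  exact image_eq_zero_of_notMem_tsupport fun h ↦
    hx (tsupport_partialDeriv_subset _ _ (tsupport_partialDeriv_subset _ _ h))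

theorem hessianNorm_sq_le (f : E N → ℝ) (x : E N) :
    hessianNorm f x ^ 2 ≤ N ^ 2 * ∑ i, ∑ j, partialDeriv j (partialDeriv i f) x ^ 2 := by
  have h : ∀ a : Fin N → ℝ, (∑ i, a i) ^ 2 ≤ N * ∑ i, a i ^ 2 := fun a ↦ by
    simpa using sq_sum_le_card_mul_sum_sq (s := Finset.univ) (f := a)
  calc hessianNorm f x ^ 2 ≤ N * ∑ i, (∑ j, |partialDeriv j (partialDeriv i f) x|) ^ 2 := h _
    _ ≤ N * ∑ i, (N * ∑ j, |partialDeriv j (partialDeriv i f) x| ^ 2) := by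
        gcongr
        exact h _
    _ = _ := by
        rw [← Finset.mul_sum, ← mul_assoc]
        simp only [sq_abs]
        ring

theorem lintegral_hessianNorm_sq_le (hf : ContDiff ℝ (⊤ : ℕ∞) f) (hf' : HasCompactSupport f) :
    ∫⁻ x, ENNReal.ofReal (hessianNorm f x) ^ 2 ≤ ENNReal.ofReal (N ^ 2) *
      ∫⁻ x, ENNReal.ofReal ((∑ i, partialDeriv i (partialDeriv i f) x) ^ 2) := by
  have hdd := fun i j ↦ contDiff_partialDeriv (contDiff_partialDeriv hf i) j
  have hcc := fun i j ↦ hasCompactSupport_partialDeriv (hasCompactSupport_partialDeriv hf' i) j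
  have hint : ∀ i j k l, Integrable fun x ↦
      partialDeriv j (partialDeriv i f) x * partialDeriv l (partialDeriv k f) x :=
    fun i j k l ↦ ((hdd i j).continuous.mul (hdd k l).continuous).integrable_of_hasCompactSupport
      (hcc k l).mul_left
  have hint1 : Integrable fun x ↦ ∑ i, ∑ j, partialDeriv j (partialDeriv i f) x ^ 2 := by
    simp_rw [sq]
    exact integrable_finsetSum _ fun i _ ↦ integrable_finsetSum _ fun j _ ↦ hint i j i j
  have hint2 : Integrable fun x ↦ (∑ i, partialDeriv i (partialDeriv i f) x) ^ 2 := by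
    simp_rw [sq (∑ i, partialDeriv i (partialDeriv i f) _), Finset.sum_mul_sum]
    exact integrable_finsetSum _ fun i _ ↦ integrable_finsetSum _ fun j _ ↦ hint i i j j
  calc ∫⁻ x, ENNReal.ofReal (hessianNorm f x) ^ 2
      ≤ ∫⁻ x, ENNReal.ofReal (N ^ 2) *
          ENNReal.ofReal (∑ i, ∑ j, partialDeriv j (partialDeriv i f) x ^ 2) := by
        refine lintegral_mono fun x ↦ ?_
        rw [← ENNReal.ofReal_pow (hessianNorm_nonneg f x), ← ENNReal.ofReal_mul (by positivity)]
        exact ENNReal.ofReal_le_ofReal (hessianNorm_sq_le f x)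
    _ = _ := by
        rw [lintegral_const_mul' _ _ ENNReal.ofReal_ne_top,
          ← ofReal_integral_eq_lintegral_ofReal hint1 (Eventually.of_forall fun x ↦
            Finset.sum_nonneg fun i _ ↦ Finset.sum_nonneg fun j _ ↦ sq_nonneg _),
          ← ofReal_integral_eq_lintegral_ofReal hint2 (Eventually.of_forall fun x ↦ sq_nonneg _),
          integral_sum_sq_hessian_eq hf hf']

end PartialDeriv

/-! ### Integration along rays -/

section Representation

/-- Taylor's formula with the remainder taken from `T`: the derivative of `r q' - q` is `r q''`, and
the boundary terms at `T` vanish. -/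
theorem abs_le_lintegral_mul_second_deriv {q q' q'' : ℝ → ℝ} {T : ℝ} (hT : 0 ≤ T)
    (h1 : ∀ r, HasDerivAt q (q' r) r) (h2 : ∀ r, HasDerivAt q' (q'' r) r) (hc : Continuous q'')
    (hqT : q T = 0) (hqT' : q' T = 0) :
    ENNReal.ofReal |q 0| ≤ ∫⁻ r in Ioi 0, ENNReal.ofReal (r * |q'' r|) := by
  have hder : ∀ r ∈ uIcc 0 T, HasDerivAt (fun r ↦ r * q' r - q r) (r * q'' r) r := by
    intro r _
    exact (((hasDerivAt_id' r).fun_mul (h2 r)).fun_sub (h1 r)).congr_deriv (by ring)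
  have hint := intervalIntegral.integral_eq_sub_of_hasDerivAt hder
    ((by fun_prop : Continuous fun r ↦ r * q'' r).intervalIntegrable _ _)
  simp only [hqT, hqT', mul_zero, sub_zero, zero_mul, zero_sub, neg_neg] at hint
  rw [← hint, intervalIntegral.integral_of_le hT]
  calc ENNReal.ofReal |∫ r in Ioc 0 T, r * q'' r| = ‖∫ r in Ioc 0 T, r * q'' r‖ₑ := by
        rw [← Real.norm_eq_abs, ofReal_norm]
    _ ≤ ∫⁻ r in Ioc 0 T, ‖r * q'' r‖ₑ := enorm_integral_le_lintegral_enorm _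
    _ = ∫⁻ r in Ioc 0 T, ENNReal.ofReal (r * |q'' r|) := by
        refine setLIntegral_congr_fun measurableSet_Ioc fun r hr ↦ ?_
        rw [← ofReal_norm, Real.norm_eq_abs, abs_mul, abs_of_pos hr.1]
    _ ≤ _ := lintegral_mono_set Ioc_subset_Ioi_self

variable {N : ℕ} {f : E N → ℝ}

theorem abs_le_lintegral_ray (hf : ContDiff ℝ (⊤ : ℕ∞) f) (hf' : HasCompactSupport f)
    (x z : E N) (hz : z ≠ 0) :
    ENNReal.ofReal |f x| ≤
      ∫⁻ r in Ioi (0 : ℝ), ENNReal.ofReal (‖z‖ ^ 2 * r) *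
        ENNReal.ofReal (hessianNorm f (x + r • z)) := by
  obtain ⟨ρ, hρ⟩ := hf'.isCompact.isBounded.subset_closedBall (0 : E N)
  -- Far enough along the ray for `x + T z` to have left a ball containing the support.
  set T : ℝ := (|ρ| + ‖x‖ + 1) / ‖z‖ with hTdef
  have hz' : 0 < ‖z‖ := norm_pos_iff.2 hz
  have hT : 0 ≤ T := by positivity
  have hout : x + T • z ∉ tsupport f := by
    intro hmem
    have h1 : ‖x + T • z‖ ≤ ρ := by simpa using hρ hmem
    have h2 : ‖T • z‖ ≤ ‖x + T • z‖ + ‖x‖ := by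
      have := norm_sub_le (x + T • z) x
      simpa using this
    rw [norm_smul, Real.norm_of_nonneg hT, hTdef, div_mul_cancel₀ _ hz'.ne'] at h2
    linarith [le_abs_self ρ]
  have hline : ∀ r : ℝ, HasDerivAt (fun r : ℝ ↦ x + r • z) z r := fun r ↦ by
    simpa using ((hasDerivAt_id' r).smul_const z).const_add x
  have hgen : ∀ {F : E N → ℝ}, ContDiff ℝ (⊤ : ℕ∞) F → ∀ r : ℝ,
      HasDerivAt (fun r : ℝ ↦ F (x + r • z)) (∑ j, z j * partialDeriv j F (x + r • z)) r := by
    intro F hF r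
    rw [← fderiv_apply_eq_sum_partialDeriv]
    exact (hF.differentiable (by simp) _).hasFDerivAt.comp_hasDerivAt r (hline r)
  have hd := fun i ↦ contDiff_partialDeriv hf i
  have hdd := fun i j ↦ contDiff_partialDeriv (hd i) j
  have h2 : ∀ r : ℝ, HasDerivAt (fun r : ℝ ↦ ∑ i, z i * partialDeriv i f (x + r • z))
      (∑ i, z i * ∑ j, z j * partialDeriv j (partialDeriv i f) (x + r • z)) r := fun r ↦
    HasDerivAt.fun_sum fun i _ ↦ (hgen (hd i) r).const_mul (z i)
  have hcont : Continuous fun r : ℝ ↦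
      ∑ i, z i * ∑ j, z j * partialDeriv j (partialDeriv i f) (x + r • z) := by
    have := fun i j ↦ (hdd i j).continuous
    fun_prop
  have hmain := abs_le_lintegral_mul_second_deriv hT (hgen hf) h2 hcont
    (image_eq_zero_of_notMem_tsupport hout)
    (Finset.sum_eq_zero fun i _ ↦ by
      rw [image_eq_zero_of_notMem_tsupport
        (fun h ↦ hout (tsupport_partialDeriv_subset f i h)), mul_zero])
  simp only [zero_smul, add_zero] at hmain
  refine hmain.trans (setLIntegral_mono' measurableSet_Ioi fun r hr ↦ ?_)
  have hr : 0 < r := hr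
  rw [← ENNReal.ofReal_mul (by positivity)]
  refine ENNReal.ofReal_le_ofReal ?_
  have hzi : ∀ i, |z i| ≤ ‖z‖ := fun i ↦ by simpa using PiLp.norm_apply_le z i
  have : |∑ i, z i * ∑ j, z j * partialDeriv j (partialDeriv i f) (x + r • z)| ≤
      ‖z‖ ^ 2 * hessianNorm f (x + r • z) := by
    rw [hessianNorm, Finset.mul_sum]
    refine (Finset.abs_sum_le_sum_abs _ _).trans (Finset.sum_le_sum fun i _ ↦ ?_)
    rw [abs_mul, Finset.mul_sum]
    calc |z i| * |∑ j, z j * partialDeriv j (partialDeriv i f) (x + r • z)|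
        ≤ ‖z‖ * ∑ j, ‖z‖ * |partialDeriv j (partialDeriv i f) (x + r • z)| := by
          refine mul_le_mul (hzi i) ?_ (abs_nonneg _) (norm_nonneg _)
          refine (Finset.abs_sum_le_sum_abs _ _).trans (Finset.sum_le_sum fun j _ ↦ ?_)
          rw [abs_mul]
          gcongr
          exact hzi j
      _ = _ := by
          rw [Finset.mul_sum]
          exact Finset.sum_congr rfl fun j _ ↦ by ring
  calc _ ≤ r * (‖z‖ ^ 2 * hessianNorm f (x + r • z)) := by gcongr
    _ = _ := by ring

theorem lintegral_comp_smul_E (F : E N → ℝ≥0∞) (hF : Measurable F) {r : ℝ} (hr : 0 < r) :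
    ∫⁻ x, F (r • x) = ENNReal.ofReal ((r ^ N)⁻¹) * ∫⁻ x, F x := by
  have h := Measure.map_addHaar_smul (volume : Measure (E N)) hr.ne'
  rw [← lintegral_map hF (measurable_const_smul r), h, lintegral_smul_measure]
  simp [abs_of_pos hr]

end Representation
-- The kernel `|x - y|⁻²` in dimension four
section Kernel

/-- The Riesz kernel `|x - y|⁻²`, the fundamental solution of the Laplacian in dimension four up to
a constant. -/
noncomputable def rieszKernel (x y : E 4) : ℝ≥0∞ := ENNReal.ofReal ((‖x - y‖ ^ 2)⁻¹)

theorem rieszKernel_symm (x y : E 4) : rieszKernel x y = rieszKernel y x := by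
  rw [rieszKernel, rieszKernel, norm_sub_rev]

theorem measurable_rieszKernel : Measurable (Function.uncurry rieszKernel) := by
  unfold Function.uncurry rieszKernel
  fun_prop

theorem lintegral_ball_rieszKernel_lt_top :
    ∫⁻ y in Metric.ball (0 : E 4) 1, rieszKernel 0 y < ∞ := by
  have h : IntegrableOn (fun x : E 4 ↦ (‖x‖ ^ 2)⁻¹) (Metric.ball (0 : E 4) 1) := by
    rw [integrableOn_fun_norm_addHaar volume (f := fun t ↦ (t ^ 2)⁻¹)]
    have : IntegrableOn (fun y : ℝ ↦ y) (Ioo 0 1) :=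
      (continuous_id.integrableOn_Icc (a := 0) (b := 1)).mono_set Ioo_subset_Icc_self
    refine this.congr_fun (fun y hy ↦ ?_) measurableSet_Ioo
    have : y ≠ 0 := hy.1.ne'
    simp only [finrank_euclideanSpace, Fintype.card_fin, smul_eq_mul]
    field_simp
  have := h.lintegral_lt_top
  simpa [rieszKernel] using this

theorem lintegral_ball_rieszKernel_eq (x : E 4) {r : ℝ} (hr : 0 < r) :
    ∫⁻ y in Metric.ball x r, rieszKernel x y =
      ENNReal.ofReal (r ^ 2) * ∫⁻ y in Metric.ball (0 : E 4) 1, rieszKernel 0 y := by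
  have hm : ∀ x : E 4, Measurable (rieszKernel x) := fun x ↦ by
    unfold rieszKernel
    fun_prop
  have h1 : ∫⁻ y in Metric.ball x r, rieszKernel x y =
      ∫⁻ y in Metric.ball (0 : E 4) r, rieszKernel 0 y := by
    rw [← lintegral_indicator measurableSet_ball, ← lintegral_indicator measurableSet_ball,
      ← lintegral_add_left_eq_self _ x]
    refine lintegral_congr fun y ↦ ?_
    simp [indicator, rieszKernel]
  have h2 := lintegral_comp_smul_E (N := 4)
    ((Metric.ball (0 : E 4) r).indicator (rieszKernel 0)) ((hm 0).indicator measurableSet_ball) hr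
  have h3 : ∀ y : E 4, (Metric.ball (0 : E 4) r).indicator (rieszKernel 0) (r • y) =
      ENNReal.ofReal ((r ^ 2)⁻¹) * (Metric.ball (0 : E 4) 1).indicator (rieszKernel 0) y := by
    intro y
    have : ‖r • y‖ = r * ‖y‖ := by rw [norm_smul, Real.norm_of_nonneg hr.le]
    by_cases hy : ‖y‖ < 1
    · rw [indicator_of_mem (by simpa [this] using (mul_lt_iff_lt_one_right hr).2 hy),
        indicator_of_mem (by simpa using hy), rieszKernel, rieszKernel,
        ← ENNReal.ofReal_mul (by positivity), zero_sub, zero_sub, norm_neg, norm_neg, this,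
        mul_pow, mul_inv]
    · rw [indicator_of_notMem (by simpa [this, le_mul_iff_one_le_right hr] using hy),
        indicator_of_notMem (by simpa using hy), mul_zero]
  simp_rw [h3] at h2
  rw [lintegral_const_mul' _ _ ENNReal.ofReal_ne_top, lintegral_indicator measurableSet_ball,
    lintegral_indicator measurableSet_ball] at h2
  rw [h1]
  have h4 : ENNReal.ofReal (r ^ 2) * ENNReal.ofReal ((r ^ 2)⁻¹) = 1 := by
    rw [← ENNReal.ofReal_mul (by positivity), mul_inv_cancel₀ (by positivity), ENNReal.ofReal_one]
  have h5 : ENNReal.ofReal (r ^ 4) * ENNReal.ofReal ((r ^ 4)⁻¹) = 1 := by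
    rw [← ENNReal.ofReal_mul (by positivity), mul_inv_cancel₀ (by positivity), ENNReal.ofReal_one]
  calc ∫⁻ y in Metric.ball (0 : E 4) r, rieszKernel 0 y
      = ENNReal.ofReal (r ^ 4) * (ENNReal.ofReal ((r ^ 4)⁻¹) *
          ∫⁻ y in Metric.ball (0 : E 4) r, rieszKernel 0 y) := by rw [← mul_assoc, h5, one_mul]
    _ = _ := by
        rw [← h2, ← mul_assoc, ← ENNReal.ofReal_mul (by positivity)]
        congr 2
        field_simp

/-- The Riesz kernel is of weak type `L²`, uniformly. -/
theorem setLIntegral_rieszKernel_le (x : E 4) (A : Set (E 4)) :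
    ∫⁻ y in A, rieszKernel x y ≤
      ((∫⁻ y in Metric.ball (0 : E 4) 1, rieszKernel 0 y) + 1) * volume A ^ (1 / 2 : ℝ) := by
  rcases eq_or_ne (volume A) 0 with h0 | h0
  · rw [setLIntegral_measure_zero _ _ h0]
    simp
  rcases eq_or_ne (volume A) ∞ with ht | ht
  · rw [ht, ENNReal.top_rpow_of_pos (by norm_num), ENNReal.mul_top (by simp)]
    exact le_top
  set v := (volume A).toReal with hv
  have hv0 : 0 < v := ENNReal.toReal_pos h0 ht
  have hvA : volume A = ENNReal.ofReal v := (ENNReal.ofReal_toReal ht).symm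
  -- With `r⁴ = |A|` both parts scale like `r² = |A|^{1/2}`: the ball by homogeneity, and the rest
  -- because the kernel is at most `r⁻²` there. The rest accounts for the `+ 1` in the constant.
  set r := v ^ (1 / 4 : ℝ) with hr
  have hr0 : 0 < r := Real.rpow_pos_of_pos hv0 _
  have hr4 : v = r ^ 4 := by
    rw [hr, ← Real.rpow_natCast, ← Real.rpow_mul hv0.le]
    norm_num
  have hhalf : volume A ^ (1 / 2 : ℝ) = ENNReal.ofReal (r ^ 2) := by
    rw [hvA, ENNReal.ofReal_rpow_of_pos hv0, hr4, ← Real.rpow_natCast r 4, ← Real.rpow_mul hr0.le,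
      ← Real.rpow_natCast r 2]
    norm_num
  have hsub : A ⊆ Metric.ball x r ∪ (A ∩ (Metric.ball x r)ᶜ) := fun y hy ↦ by
    by_cases h : y ∈ Metric.ball x r
    · exact Or.inl h
    · exact Or.inr ⟨hy, h⟩
  calc ∫⁻ y in A, rieszKernel x y
      ≤ (∫⁻ y in Metric.ball x r, rieszKernel x y) +
          ∫⁻ y in A ∩ (Metric.ball x r)ᶜ, rieszKernel x y :=
        (lintegral_mono_set hsub).trans (lintegral_union_le _ _ _)
    _ ≤ ENNReal.ofReal (r ^ 2) * (∫⁻ y in Metric.ball (0 : E 4) 1, rieszKernel 0 y) +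
          ENNReal.ofReal (r ^ 2) := by
        refine add_le_add (lintegral_ball_rieszKernel_eq x hr0).le ?_
        calc ∫⁻ y in A ∩ (Metric.ball x r)ᶜ, rieszKernel x y
            ≤ ∫⁻ y in A ∩ (Metric.ball x r)ᶜ, ENNReal.ofReal ((r ^ 2)⁻¹) := by
              refine setLIntegral_mono measurable_const fun y hy ↦ ?_
              have : r ≤ ‖x - y‖ := by
                have := hy.2
                rw [mem_compl_iff, Metric.mem_ball, not_lt, dist_comm, dist_eq_norm] at this
                exact this
              rw [rieszKernel]
              gcongr
          _ ≤ ENNReal.ofReal ((r ^ 2)⁻¹) * volume A := by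
              rw [setLIntegral_const]
              gcongr
              exact inter_subset_left
          _ = ENNReal.ofReal (r ^ 2) := by
              rw [hvA, hr4, ← ENNReal.ofReal_mul (by positivity)]
              congr 1
              field_simp
    _ = _ := by
        rw [hhalf]
        ring

end Kernel

/-! ### Pointwise domination by the Riesz potential of the Hessian -/

section Representation

/-- The annulus `1 ≤ |z| ≤ 2`. -/
def unitAnnulus : Set (E 4) := {z | 1 ≤ ‖z‖ ∧ ‖z‖ ≤ 2}

theorem measurableSet_unitAnnulus : MeasurableSet unitAnnulus :=
  (measurableSet_le measurable_const measurable_norm).inter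
    (measurableSet_le measurable_norm measurable_const)

theorem volume_unitAnnulus_ne_top : volume unitAnnulus ≠ ∞ := by
  refine ((measure_mono fun z hz ↦ ?_).trans_lt
    (measure_closedBall_lt_top (x := (0 : E 4)) (r := 2))).ne
  simpa using hz.2

theorem volume_unitAnnulus_ne_zero : volume unitAnnulus ≠ 0 := by
  have ho : IsOpen {z : E 4 | 1 < ‖z‖ ∧ ‖z‖ < 2} :=
    (isOpen_lt continuous_const continuous_norm).inter (isOpen_lt continuous_norm continuous_const)
  have hne : {z : E 4 | 1 < ‖z‖ ∧ ‖z‖ < 2}.Nonempty :=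
    ⟨EuclideanSpace.single 0 (3 / 2), by norm_num⟩
  exact ((ho.measure_pos volume hne).trans_le
    (measure_mono fun z (hz : _ ∧ _) ↦ (⟨hz.1.le, hz.2.le⟩ : _ ∧ _))).ne'

/-- Only `|y| / 2 ≤ r ≤ |y|` contributes; there the integrand is at most `4 · 8 / |y|³`, on an
interval of length `|y| / 2`. -/
theorem lintegral_annulus_scaling_le (y : E 4) :
    ∫⁻ r in Ioi (0 : ℝ), ENNReal.ofReal (4 * (r ^ 3)⁻¹) * unitAnnulus.indicator 1 (r⁻¹ • y) ≤
      ENNReal.ofReal (16 * (‖y‖ ^ 2)⁻¹) := by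
  rcases eq_or_ne y 0 with rfl | hy
  · have : (0 : E 4) ∉ unitAnnulus := fun h ↦ by
      have := h.1
      norm_num at this
    simp [this]
  have hy0 : 0 < ‖y‖ := norm_pos_iff.2 hy
  calc _ ≤ ∫⁻ r in Ioi (0 : ℝ), (Icc (‖y‖ / 2) ‖y‖).indicator
          (fun _ ↦ ENNReal.ofReal (32 * (‖y‖ ^ 3)⁻¹)) r := by
        refine setLIntegral_mono' measurableSet_Ioi fun r hr ↦ ?_
        have hr : 0 < r := hr
        by_cases hmem : r⁻¹ • y ∈ unitAnnulus
        · have hn : ‖r⁻¹ • y‖ = ‖y‖ / r := by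
            rw [norm_smul, norm_inv, Real.norm_of_nonneg hr.le, div_eq_inv_mul]
          have h1 := hmem.1
          have h2 := hmem.2
          rw [hn, le_div_iff₀ hr, one_mul] at h1
          rw [hn, div_le_iff₀ hr] at h2
          have h3 : ‖y‖ / 2 ≤ r := by linarith
          rw [indicator_of_mem hmem, indicator_of_mem (mem_Icc.2 ⟨h3, h1⟩), Pi.one_apply, mul_one]
          refine ENNReal.ofReal_le_ofReal ?_
          calc 4 * (r ^ 3)⁻¹ ≤ 4 * ((‖y‖ / 2) ^ 3)⁻¹ := by gcongr
            _ = _ := by field_simp; norm_num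
        · rw [indicator_of_notMem hmem, mul_zero]
          exact bot_le
    _ ≤ ∫⁻ r, (Icc (‖y‖ / 2) ‖y‖).indicator
          (fun _ ↦ ENNReal.ofReal (32 * (‖y‖ ^ 3)⁻¹)) r := setLIntegral_le_lintegral _ _
    _ = ENNReal.ofReal (16 * (‖y‖ ^ 2)⁻¹) := by
        rw [lintegral_indicator measurableSet_Icc, setLIntegral_const, Real.volume_Icc,
          ← ENNReal.ofReal_mul (by positivity)]
        congr 1
        field_simp
        norm_num

variable {f : E 4 → ℝ}

/-- A smooth compactly supported function on `ℝ⁴` is dominated by the Riesz potential of order two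
of its Hessian. -/
theorem volume_unitAnnulus_mul_abs_le (hf : ContDiff ℝ (⊤ : ℕ∞) f) (hf' : HasCompactSupport f)
    (x : E 4) :
    volume unitAnnulus * ENNReal.ofReal |f x| ≤
      16 * ∫⁻ y, rieszKernel x y * ENNReal.ofReal (hessianNorm f y) := by
  set h : E 4 → ℝ≥0∞ := fun y ↦ ENNReal.ofReal (hessianNorm f y) with hh
  have hm : Measurable h := (continuous_hessianNorm hf).measurable.ennreal_ofReal
  have hind : Measurable (unitAnnulus.indicator (1 : E 4 → ℝ≥0∞)) :=
    measurable_one.indicator measurableSet_unitAnnulus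
  calc volume unitAnnulus * ENNReal.ofReal |f x| = ∫⁻ z in unitAnnulus, ENNReal.ofReal |f x| := by
        rw [setLIntegral_const, mul_comm]
    -- Integrating the ray bound over the directions `z` makes it a volume integral; the `4` bounds
    -- `|z|²`.
    _ ≤ ∫⁻ z in unitAnnulus, ∫⁻ r in Ioi (0 : ℝ), ENNReal.ofReal (4 * r) * h (x + r • z) := by
        refine setLIntegral_mono' measurableSet_unitAnnulus fun z hz ↦ ?_
        have hz0 : z ≠ 0 := fun h0 ↦ by
          have := hz.1
          rw [h0] at this
          norm_num at this
        refine (abs_le_lintegral_ray hf hf' x z hz0).trans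
          (setLIntegral_mono' measurableSet_Ioi fun r hr ↦ ?_)
        have hr : 0 < r := hr
        have : ‖z‖ ^ 2 ≤ 4 := by nlinarith [hz.1, hz.2]
        gcongr
    _ = ∫⁻ r in Ioi (0 : ℝ), ∫⁻ z in unitAnnulus, ENNReal.ofReal (4 * r) * h (x + r • z) := by
        refine lintegral_lintegral_swap ?_
        refine Measurable.aemeasurable ?_
        unfold Function.uncurry
        fun_prop
    -- The substitution `y = r z` has Jacobian `r⁻⁴`, which turns `r` into `r⁻³`.
    _ = ∫⁻ r in Ioi (0 : ℝ), ∫⁻ y, ENNReal.ofReal (4 * (r ^ 3)⁻¹) *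
          unitAnnulus.indicator 1 (r⁻¹ • y) * h (x + y) := by
        refine setLIntegral_congr_fun measurableSet_Ioi fun r hr ↦ ?_
        have hr : 0 < r := hr
        have hsc := lintegral_comp_smul_E (N := 4)
          (fun y ↦ unitAnnulus.indicator 1 (r⁻¹ • y) * h (x + y)) (by fun_prop) hr
        simp only [smul_smul, inv_mul_cancel₀ hr.ne', one_smul] at hsc
        simp only [mul_assoc]
        rw [lintegral_const_mul' _ _ ENNReal.ofReal_ne_top,
          lintegral_const_mul' _ _ ENNReal.ofReal_ne_top]
        have e : ∫⁻ z in unitAnnulus, h (x + r • z) =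
            ∫⁻ z, unitAnnulus.indicator 1 z * h (x + r • z) := by
          rw [← lintegral_indicator measurableSet_unitAnnulus]
          refine lintegral_congr fun z ↦ ?_
          by_cases hz : z ∈ unitAnnulus <;> simp [hz]
        rw [e, hsc, ← mul_assoc, ← ENNReal.ofReal_mul (by positivity)]
        congr 2
        field_simp
    _ = ∫⁻ y, ∫⁻ r in Ioi (0 : ℝ), ENNReal.ofReal (4 * (r ^ 3)⁻¹) *
          unitAnnulus.indicator 1 (r⁻¹ • y) * h (x + y) := by
        refine lintegral_lintegral_swap ?_
        refine Measurable.aemeasurable ?_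
        unfold Function.uncurry
        have : Measurable fun a : ℝ × E 4 ↦ unitAnnulus.indicator (1 : E 4 → ℝ≥0∞) (a.1⁻¹ • a.2) :=
          hind.comp (by fun_prop)
        fun_prop
    _ ≤ ∫⁻ y, 16 * (rieszKernel x (x + y) * h (x + y)) := by
        refine lintegral_mono fun y ↦ ?_
        rw [lintegral_mul_const' _ _ ENNReal.ofReal_ne_top, ← mul_assoc]
        gcongr
        refine (lintegral_annulus_scaling_le y).trans (le_of_eq ?_)
        rw [rieszKernel, ENNReal.ofReal_mul (by norm_num)]
        simp
    _ = _ := by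
        rw [lintegral_const_mul' _ _ (by norm_num),
          lintegral_add_left_eq_self (fun y ↦ rieszKernel x y * h y) x]

end Representation
-- Sufficiency: from test functions to `H²₀`
section Sufficiency

variable {Ω : Opens (E 4)} {g : E 4 → ℝ≥0∞}

theorem lintegral_ofReal_sq_eq_eLpNorm_sq {X : Type*} [MeasurableSpace X] (m : Measure X)
    (v : X → ℝ) : ∫⁻ x, ENNReal.ofReal (v x ^ 2) ∂m = eLpNorm v 2 m ^ 2 := by
  have h := eLpNorm_nnreal_pow_eq_lintegral (f := v) (μ := m) (p := 2) (by norm_num)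
  norm_num at h
  rw [h]
  refine lintegral_congr fun x ↦ ?_
  rw [← ofReal_norm, ← ENNReal.ofReal_pow (norm_nonneg _), Real.norm_eq_abs, sq_abs]

theorem lintegral_mul_sq_le_of_le {X : Type*} [MeasurableSpace X] (m : Measure X)
    {h : X → ℝ≥0∞} {u : X → ℝ} {F : X → ℝ≥0∞} {a b : ℝ≥0∞} (ha : a ≠ 0) (ha' : a ≠ ∞)
    (hb : b ≠ ∞)
    (hu : ∀ x, a * ENNReal.ofReal |u x| ≤ b * F x) :
    ∫⁻ x, h x * ENNReal.ofReal (u x ^ 2) ∂m ≤ (b / a) ^ 2 * ∫⁻ x, h x * F x ^ 2 ∂m := by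
  rw [← lintegral_const_mul' _ _ (ENNReal.pow_ne_top (ENNReal.div_ne_top hb ha))]
  refine lintegral_mono fun x ↦ ?_
  have h1 : ENNReal.ofReal |u x| ≤ b / a * F x := by
    rw [← ENNReal.mul_le_mul_iff_right ha ha']
    refine (hu x).trans (le_of_eq ?_)
    rw [← mul_assoc, ENNReal.mul_div_cancel ha ha']
  calc h x * ENNReal.ofReal (u x ^ 2) = h x * ENNReal.ofReal |u x| ^ 2 := by
        rw [← sq_abs, ENNReal.ofReal_pow (abs_nonneg _)]
    _ ≤ h x * (b / a * F x) ^ 2 := by gcongr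
    _ = _ := by ring

/-- The weighted Rellich inequality for test functions. -/
theorem exists_lintegral_mul_sq_testFunction_le (hΩ : volume (Ω : Set (E 4)) ≠ ∞)
    (hg : MemMLogL Ω g) :
    ∃ K : ℝ≥0∞, K ≠ ∞ ∧ ∀ φ : 𝓓(Ω, ℝ),
      ∫⁻ x in (Ω : Set (E 4)), g x * ENNReal.ofReal (φ x ^ 2) ≤
        K * ∫⁻ x in (Ω : Set (E 4)),
          ENNReal.ofReal ((∑ i, partialDeriv i (partialDeriv i φ) x) ^ 2) := by
  set m := volume.restrict (Ω : Set (E 4)) with hm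
  have : IsFiniteMeasure m := ⟨by simpa [hm] using hΩ.lt_top⟩
  set c : ℝ≥0∞ := (∫⁻ y in Metric.ball (0 : E 4) 1, rieszKernel 0 y) + 1 with hc
  have hctop : c ≠ ∞ := ENNReal.add_ne_top.2 ⟨lintegral_ball_rieszKernel_lt_top.ne, by simp⟩
  have hc0 : c ≠ 0 := by simp [hc]
  -- The factors come from the pointwise domination, from the trace inequality with `M = 4 ‖g‖`, and
  -- from `4²` in comparing the `ℓ¹` norm of the Hessian with the Laplacian.
  refine ⟨(16 / volume unitAnnulus) ^ 2 * (40 * c ^ 2 * (4 * mLogLNorm Ω g) * 16), ?_, ?_⟩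
  · refine ENNReal.mul_ne_top (ENNReal.pow_ne_top (ENNReal.div_ne_top (by norm_num)
      volume_unitAnnulus_ne_zero)) ?_
    refine ENNReal.mul_ne_top (ENNReal.mul_ne_top (ENNReal.mul_ne_top (by norm_num)
      (ENNReal.pow_ne_top hctop)) (ENNReal.mul_ne_top (by norm_num) hg.2.ne)) (by norm_num)
  intro φ
  have hφ : ContDiff ℝ (⊤ : ℕ∞) φ := φ.contDiff
  have hφ' : HasCompactSupport φ := φ.hasCompactSupport
  have hrestr : ∀ {v : E 4 → ℝ≥0∞}, (∀ x, x ∉ tsupport φ → v x = 0) →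
      ∫⁻ x, v x = ∫⁻ x, v x ∂m := fun {v} hv ↦ by
    rw [hm, ← lintegral_indicator Ω.isOpen.measurableSet]
    refine lintegral_congr fun x ↦ ?_
    by_cases hx : x ∈ (Ω : Set (E 4))
    · rw [indicator_of_mem hx]
    · rw [indicator_of_notMem hx, hv x fun h ↦ hx (φ.tsupport_subset h)]
  set f : E 4 → ℝ≥0∞ := fun x ↦ ENNReal.ofReal (hessianNorm φ x) with hf
  have hf_meas : Measurable f := (continuous_hessianNorm hφ).measurable.ennreal_ofReal
  have hf0 : ∀ x, x ∉ tsupport φ → f x = 0 := fun x hx ↦ by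
    simp [hf, hessianNorm_eq_zero_of_notMem_tsupport hx]
  have hL0 : ∀ x, x ∉ tsupport φ →
      ENNReal.ofReal ((∑ i, partialDeriv i (partialDeriv i φ) x) ^ 2) = 0 := fun x hx ↦ by
    rw [Finset.sum_eq_zero]
    · simp
    · exact fun i _ ↦ image_eq_zero_of_notMem_tsupport fun h ↦
        hx (tsupport_partialDeriv_subset _ _ (tsupport_partialDeriv_subset _ _ h))
  have hbound : ∫⁻ y, f y ^ 2 ∂m ≤ 16 * ∫⁻ x, ENNReal.ofReal
      ((∑ i, partialDeriv i (partialDeriv i φ) x) ^ 2) ∂m := by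
    rw [← hrestr fun x hx ↦ by simp [hf0 x hx], ← hrestr hL0]
    have := lintegral_hessianNorm_sq_le hφ hφ'
    norm_num at this
    exact this
  have hf2 : ∫⁻ y, f y ^ 2 ∂m ≠ ∞ := by
    have hc2 : HasCompactSupport fun y ↦ hessianNorm φ y ^ 2 :=
      hφ'.mono' fun y hy ↦ by
        by_contra h
        simp [hessianNorm_eq_zero_of_notMem_tsupport h] at hy
    have := (((continuous_hessianNorm hφ).pow 2).integrable_of_hasCompactSupport
      (μ := m) hc2).lintegral_lt_top
    simpa only [hf, ← ENNReal.ofReal_pow (hessianNorm_nonneg _ _), Pi.pow_apply] using this.ne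
  have hmain := lintegral_mul_sq_potential_le m rieszKernel c measurable_rieszKernel
    rieszKernel_symm (fun x A hA ↦ by
      rw [hm, Measure.restrict_restrict hA, Measure.restrict_apply hA]
      exact setLIntegral_rieszKernel_le x _) hctop hc0 hg.1
    (fun n A _ hAn ↦ setLIntegral_le_of_mLogLNorm hΩ hg.1 n hAn) hf_meas hf2
  calc ∫⁻ x, g x * ENNReal.ofReal (φ x ^ 2) ∂m
      ≤ (16 / volume unitAnnulus) ^ 2 *
          ∫⁻ x, g x * (∫⁻ y, rieszKernel x y * f y ∂m) ^ 2 ∂m := by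
        refine lintegral_mul_sq_le_of_le m volume_unitAnnulus_ne_zero volume_unitAnnulus_ne_top
          (by norm_num) fun x ↦ ?_
        rw [← hrestr fun y hy ↦ by simp [hf0 y hy]]
        exact volume_unitAnnulus_mul_abs_le hφ hφ' x
    _ ≤ (16 / volume unitAnnulus) ^ 2 *
          (40 * c ^ 2 * (4 * mLogLNorm Ω g) * (16 * ∫⁻ x, ENNReal.ofReal
            ((∑ i, partialDeriv i (partialDeriv i φ) x) ^ 2) ∂m)) := by
        gcongr
        exact hmain.trans (by gcongr)
    _ = _ := by ring

theorem laplacianOfHessian_eq_sum {N : ℕ} (H : Fin N → Fin N → E N → ℝ) :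
    laplacianOfHessian H = ∑ i, H i i := by
  ext x
  simp [laplacianOfHessian, Finset.sum_apply]

theorem eLpNorm_sum_le_add_sum_sub {X ι : Type*} [MeasurableSpace X] [Fintype ι] {m : Measure X}
    {a b : ι → X → ℝ} (ha : ∀ i, AEStronglyMeasurable (a i) m)
    (hb : ∀ i, AEStronglyMeasurable (b i) m) :
    eLpNorm (∑ i, b i) 2 m ≤ eLpNorm (∑ i, a i) 2 m + ∑ i, eLpNorm (a i - b i) 2 m := by
  have hsplit : ∑ i, b i = ∑ i, a i - ∑ i, (a i - b i) := by
    rw [Finset.sum_sub_distrib, sub_sub_cancel]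
  rw [hsplit]
  refine (eLpNorm_sub_le (Finset.aestronglyMeasurable_sum _ fun i _ ↦ ha i)
    (Finset.aestronglyMeasurable_sum _ fun i _ ↦ (ha i).sub (hb i)) (by norm_num)).trans ?_
  gcongr
  exact eLpNorm_sum_le (fun i _ ↦ (ha i).sub (hb i)) (by norm_num)

/-- Passage to the limit in a weighted inequality, by Fatou's lemma. -/
theorem lintegral_mul_sq_le_of_tendsto {X : Type*} [MeasurableSpace X] {m : Measure X}
    {g : X → ℝ≥0∞} (hg : AEMeasurable g m) (hgfin : ∀ᵐ x ∂m, g x ≠ ∞) {u : X → ℝ} {φ : ℕ → X → ℝ}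
    (hφ : ∀ n, Measurable (φ n)) (hu : AEStronglyMeasurable u m)
    (h0 : Tendsto (fun n ↦ eLpNorm (fun x ↦ u x - φ n x) 2 m) atTop (𝓝 0))
    {a : ℕ → ℝ≥0∞} {b : ℝ≥0∞} (ha : Tendsto a atTop (𝓝 b))
    (h : ∀ n, ∫⁻ x, g x * ENNReal.ofReal (φ n x ^ 2) ∂m ≤ a n) :
    ∫⁻ x, g x * ENNReal.ofReal (u x ^ 2) ∂m ≤ b := by
  have hmeas : TendstoInMeasure m φ atTop u := by
    refine tendstoInMeasure_of_tendsto_eLpNorm (p := 2) (by norm_num)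
      (fun n ↦ (hφ n).aestronglyMeasurable) hu ?_
    refine h0.congr fun n ↦ ?_
    rw [eLpNorm_sub_comm]
    rfl
  obtain ⟨ns, hns, hae⟩ := hmeas.exists_seq_tendsto_ae
  calc ∫⁻ x, g x * ENNReal.ofReal (u x ^ 2) ∂m
      = ∫⁻ x, liminf (fun n ↦ g x * ENNReal.ofReal (φ (ns n) x ^ 2)) atTop ∂m := by
        refine lintegral_congr_ae ?_
        -- Finiteness of `g x` is needed here: multiplication by `∞` is not continuous at `0`.
        filter_upwards [hae, hgfin] with x hx hgx
        refine (Tendsto.liminf_eq ?_).symm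
        exact ENNReal.Tendsto.const_mul (ENNReal.tendsto_ofReal (hx.pow 2)) (Or.inr hgx)
    _ ≤ liminf (fun n ↦ ∫⁻ x, g x * ENNReal.ofReal (φ (ns n) x ^ 2) ∂m) atTop :=
        lintegral_liminf_le' fun n ↦ hg.mul ((hφ _).pow_const 2).ennreal_ofReal.aemeasurable
    _ ≤ liminf (fun n ↦ a (ns n)) atTop :=
        liminf_le_liminf (Eventually.of_forall fun n ↦ h (ns n))
    _ = b := (ha.comp hns.tendsto_atTop).liminf_eq

/-- Passage to the limit from test functions to `H²₀`. -/
theorem lintegral_mul_sq_le_of_isH20 {N : ℕ} {Ω : Opens (E N)} {g : E N → ℝ≥0∞}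
    (hg : AEMeasurable g (volume.restrict (Ω : Set (E N))))
    (hgfin : ∀ᵐ x ∂(volume.restrict (Ω : Set (E N))), g x ≠ ∞) {K : ℝ≥0∞} (hK : K ≠ ∞)
    (h : ∀ φ : 𝓓(Ω, ℝ), ∫⁻ x in (Ω : Set (E N)), g x * ENNReal.ofReal (φ x ^ 2) ≤
      K * ∫⁻ x in (Ω : Set (E N)),
        ENNReal.ofReal ((∑ i, partialDeriv i (partialDeriv i φ) x) ^ 2))
    {u : E N → ℝ} {G : Fin N → E N → ℝ} {H : Fin N → Fin N → E N → ℝ} (hu : IsH20 Ω u G H) :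
    ∫⁻ x in (Ω : Set (E N)), g x * ENNReal.ofReal (u x ^ 2) ≤
      K * ∫⁻ x in (Ω : Set (E N)), ENNReal.ofReal (laplacianOfHessian H x ^ 2) := by
  obtain ⟨φ, hφ0, -, hφ2⟩ := hu.approx
  have hdd : ∀ n i, Continuous (partialDeriv i (partialDeriv i (φ n))) := fun n i ↦
    (contDiff_partialDeriv (contDiff_partialDeriv (φ n).contDiff i) i).continuous
  have hε0 := tendsto_finsetSum Finset.univ fun i _ ↦ hφ2 i i
  rw [Finset.sum_const_zero] at hε0
  rw [lintegral_ofReal_sq_eq_eLpNorm_sq, laplacianOfHessian_eq_sum]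
  have h1 := (tendsto_const_nhds (x := eLpNorm (∑ i, H i i) 2
    (volume.restrict (Ω : Set (E N))))).add hε0
  rw [add_zero] at h1
  refine lintegral_mul_sq_le_of_tendsto hg hgfin (fun n ↦ (φ n).continuous.measurable)
    hu.memLp.aestronglyMeasurable hφ0 (ENNReal.Tendsto.const_mul (ENNReal.Tendsto.pow h1)
      (Or.inr hK)) fun n ↦ (h (φ n)).trans ?_
  rw [lintegral_ofReal_sq_eq_eLpNorm_sq]
  gcongr
  have h2 := eLpNorm_sum_le_add_sum_sub (fun i ↦ (hu.memLp_hess i i).aestronglyMeasurable)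
    (fun i ↦ (hdd n i).aestronglyMeasurable (μ := volume.restrict (Ω : Set (E N))))
  refine le_trans (le_of_eq ?_) h2
  congr 1
  ext x
  simp

/-- Weights in `𝓜 log L` are admissible. -/
theorem admissible_of_memMLogL (hΩ : volume (Ω : Set (E 4)) ≠ ∞) (hg : MemMLogL Ω g) :
    Admissible Ω g := by
  obtain ⟨K, hK, hφ⟩ := exists_lintegral_mul_sq_testFunction_le hΩ hg
  have hgint : ∫⁻ x in (Ω : Set (E 4)), g x < ∞ := by
    -- The case `n = 0` with the whole space gives integrability of `g` on `Ω`, hence local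
    -- integrability and finiteness almost everywhere.
    have := setLIntegral_le_of_mLogLNorm hΩ hg.1 0 (A := univ) (by simp)
    rw [setLIntegral_univ] at this
    refine this.trans_lt ?_
    simpa using ENNReal.mul_lt_top (by norm_num) hg.2
  refine ⟨hg.1, fun A _ hA ↦ (lintegral_mono_set hA).trans_lt hgint, K.toReal + 1, by positivity,
    fun u G H hu ↦ ?_⟩
  refine (lintegral_mul_sq_le_of_isH20 hg.1 ?_ hK hφ hu).trans ?_
  · filter_upwards [ae_lt_top' hg.1 hgint.ne] with x hx using hx.ne
  · gcongr
    rw [← ENNReal.ofReal_toReal hK]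
    exact ENNReal.ofReal_le_ofReal (by simp)

end Sufficiency
-- Radially decreasing weights, and test functions in `H²₀`
section Radial

variable {N : ℕ} {Ω : Opens (E N)} {g : E N → ℝ≥0∞}

/-- For a radially decreasing weight, `∫₀ᵗ g^*` is at most the integral of `g` over the centered
ball of measure `t`. -/
theorem lintegral_rearrangement_le_setLIntegral_ball
    (hg : AEMeasurable g (volume.restrict (Ω : Set (E N)))) (hdec : IsRadiallyDecreasing Ω g)
    {r : ℝ} (hr : Metric.ball 0 r ⊆ (Ω : Set (E N))) :
    ∫⁻ τ in Ioo 0 (volume.real (Metric.ball (0 : E N) r)), rearrangement Ω g τ ≤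
      ∫⁻ x in Metric.ball (0 : E N) r, g x := by
  rw [lintegral_rearrangement_eq,
    lintegral_eq_lintegral_meas_ofReal_lt (hg.mono_measure (Measure.restrict_mono hr le_rfl)),
    Measure.real, ENNReal.ofReal_toReal measure_ball_lt_top.ne]
  refine lintegral_mono fun s ↦ ?_
  rw [Measure.restrict_apply' measurableSet_ball]
  -- By monotonicity a superlevel set either contains the ball or is contained in it, so the measure
  -- of its intersection with the ball is the minimum of the two measures.
  by_cases h : ∃ x ∈ Ω, x ∉ Metric.ball (0 : E N) r ∧ ENNReal.ofReal s < g x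
  · obtain ⟨x, hx, hxr, hsx⟩ := h
    refine (min_le_left _ _).trans (measure_mono fun y hy ↦ ⟨?_, hy⟩)
    refine hsx.trans_le (hdec y (hr hy) x hx ?_)
    rw [mem_ball_zero_iff] at hy hxr
    linarith
  · push Not at h
    refine (min_le_right _ _).trans (measure_mono fun x hx ↦ ⟨hx.2, ?_⟩)
    by_contra hxr
    exact absurd hx.2 (not_lt.2 (h x hx.1 hxr))

/-- A radially decreasing, locally integrable weight on a ball is integrable. -/
theorem lintegral_lt_top_of_isRadiallyDecreasing [NeZero N] {R : ℝ} (hR : 0 < R)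
    (hΩ : (Ω : Set (E N)) = Metric.ball 0 R) (hdec : IsRadiallyDecreasing Ω g)
    (hloc : ∀ K : Set (E N), IsCompact K → K ⊆ Ω → ∫⁻ x in K, g x < ∞) :
    ∫⁻ x in (Ω : Set (E N)), g x < ∞ := by
  set B := Metric.closedBall (0 : E N) (R / 2) with hB
  have hmem : ∀ x : E N, x ∈ Ω ↔ ‖x‖ < R := fun x ↦ by
    rw [← SetLike.mem_coe, hΩ, mem_ball_zero_iff]
  have hBΩ : B ⊆ Ω := fun x hx ↦ (hmem x).2 (by
    have : ‖x‖ ≤ R / 2 := by simpa [hB] using hx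
    linarith)
  have hBint := hloc B (isCompact_closedBall _ _) hBΩ
  obtain ⟨x₀, hx₀⟩ : ∃ x : E N, ‖x‖ = R / 2 :=
    ⟨EuclideanSpace.single 0 (R / 2), by simp [abs_of_pos hR]⟩
  have hx₀Ω : x₀ ∈ Ω := (hmem _).2 (by linarith)
  -- An infinite value at radius `R / 2` would make `g` infinite on the whole half ball, against
  -- local integrability. Its finite value then bounds `g` farther out.
  have hgx₀ : g x₀ ≠ ∞ := by
    intro htop
    have h1 : ∫⁻ x in B, ∞ ≤ ∫⁻ x in B, g x :=
      setLIntegral_mono' Metric.isClosed_closedBall.measurableSet fun y hy ↦ by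
        rw [← htop]
        exact hdec y (hBΩ hy) x₀ hx₀Ω (by simpa [hB, hx₀] using hy)
    rw [setLIntegral_const, ENNReal.top_mul
      (Metric.measure_closedBall_pos volume _ (by positivity)).ne'] at h1
    exact absurd hBint (not_lt.2 h1)
  have hsub : (Ω : Set (E N)) ⊆ B ∪ (Ω \ B) := fun x hx ↦ by
    by_cases h : x ∈ B
    · exact Or.inl h
    · exact Or.inr ⟨hx, h⟩
  refine ((lintegral_mono_set hsub).trans (lintegral_union_le _ _ _)).trans_lt
    (ENNReal.add_lt_top.2 ⟨hBint, ?_⟩)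
  calc ∫⁻ x in Ω \ B, g x ≤ ∫⁻ x in Ω \ B, g x₀ :=
        setLIntegral_mono' (Ω.isOpen.measurableSet.diff Metric.isClosed_closedBall.measurableSet)
          fun y hy ↦ hdec x₀ hx₀Ω y hy.1 (by
            have := hy.2
            rw [hB, mem_closedBall_zero_iff, not_le] at this
            linarith)
    _ = g x₀ * volume ((Ω : Set (E N)) \ B) := setLIntegral_const _ _
    _ < ∞ := ENNReal.mul_lt_top hgx₀.lt_top ((measure_mono sdiff_subset).trans_lt (by
        rw [hΩ]
        exact measure_ball_lt_top))

theorem isH20_testFunction (φ : 𝓓(Ω, ℝ)) :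
    IsH20 Ω φ (fun i ↦ partialDeriv i φ) fun i j ↦ partialDeriv j (partialDeriv i φ) := by
  have hφ : ContDiff ℝ (⊤ : ℕ∞) φ := φ.contDiff
  have hφ' : HasCompactSupport φ := φ.hasCompactSupport
  have hd := fun i ↦ contDiff_partialDeriv hφ i
  have hd' := fun i ↦ hasCompactSupport_partialDeriv hφ' i
  have hweak : ∀ {v : E N → ℝ}, ContDiff ℝ (⊤ : ℕ∞) v → ∀ i,
      IsWeakPartial Ω i v (partialDeriv i v) := by
    intro v hv i ψ
    rw [setIntegral_eq_integral_of_forall_compl_eq_zero,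
      setIntegral_eq_integral_of_forall_compl_eq_zero]
    · exact integral_mul_partialDeriv hv ψ.contDiff ψ.hasCompactSupport i
    · intro x hx
      rw [image_eq_zero_of_notMem_tsupport fun h ↦ hx (ψ.tsupport_subset h), mul_zero]
    · intro x hx
      rw [image_eq_zero_of_notMem_tsupport fun h ↦
        hx (ψ.tsupport_subset (tsupport_partialDeriv_subset _ _ h)), mul_zero]
  exact
    { memLp := φ.continuous.memLp_of_hasCompactSupport hφ'
      memLp_grad := fun i ↦ (hd i).continuous.memLp_of_hasCompactSupport (hd' i)
      memLp_hess := fun i j ↦ (contDiff_partialDeriv (hd i) j).continuous.memLp_of_hasCompactSupport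
        (hasCompactSupport_partialDeriv (hd' i) j)
      weak_grad := fun i ↦ hweak hφ i
      weak_hess := fun i j ↦ hweak (hd i) j
      approx := ⟨fun _ ↦ φ, by simp, by simp, by simp⟩ }

end Radial

/-! ### Logarithmic cutoff functions -/

section LogCutoff

theorem exists_bound_deriv_smoothTransition :
    ∃ K : ℝ, 0 < K ∧ ∀ s, |deriv Real.smoothTransition s| ≤ K ∧
      |deriv (deriv Real.smoothTransition) s| ≤ K := by
  have hsm : ContDiff ℝ (⊤ : ℕ∞) Real.smoothTransition := Real.smoothTransition.contDiff
  have hd : ContDiff ℝ (⊤ : ℕ∞) (deriv Real.smoothTransition) :=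
    ((contDiff_infty_iff_deriv (𝕜 := ℝ)).1 hsm).2
  have hdd : ContDiff ℝ (⊤ : ℕ∞) (deriv (deriv Real.smoothTransition)) :=
    ((contDiff_infty_iff_deriv (𝕜 := ℝ)).1 hd).2
  obtain ⟨K₁, hK₁⟩ := isCompact_Icc.exists_bound_of_continuousOn (s := Icc (0 : ℝ) 1)
    hd.continuous.continuousOn
  obtain ⟨K₂, hK₂⟩ := isCompact_Icc.exists_bound_of_continuousOn (s := Icc (0 : ℝ) 1)
    hdd.continuous.continuousOn
  refine ⟨max K₁ K₂ ⊔ 1, by positivity, fun s ↦ ?_⟩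
  by_cases hs : s ∈ Icc (0 : ℝ) 1
  · exact ⟨(hK₁ s hs).trans ((le_max_left _ _).trans (le_max_left _ _)),
      (hK₂ s hs).trans ((le_max_right _ _).trans (le_max_left _ _))⟩
  -- Outside `[0, 1]` the transition is locally constant, so both derivatives vanish.
  · have hconst : ∃ c : ℝ, Real.smoothTransition =ᶠ[𝓝 s] fun _ ↦ c := by
      rcases lt_or_ge s 0 with h | h
      · exact ⟨0, (eventually_lt_nhds h).mono fun t ht ↦
          Real.smoothTransition.zero_of_nonpos ht.le⟩
      · have : 1 < s := by
          by_contra! h1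
          exact hs ⟨h, h1⟩
        exact ⟨1, (eventually_gt_nhds this).mono fun t ht ↦
          Real.smoothTransition.one_of_one_le ht.le⟩
    obtain ⟨c, hc⟩ := hconst
    have h1 : deriv Real.smoothTransition =ᶠ[𝓝 s] fun _ ↦ 0 := by
      simpa using hc.deriv
    rw [h1.eq_of_nhds, h1.deriv_eq]
    simp

variable {N : ℕ}

theorem hasFDerivAt_comp_norm_sq_add {F : ℝ → ℝ} {F' c : ℝ} {x : E N}
    (hF : HasDerivAt F F' (‖x‖ ^ 2 + c)) :
    HasFDerivAt (fun y : E N ↦ F (‖y‖ ^ 2 + c)) (F' • (2 • innerSL ℝ x)) x :=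
  hF.comp_hasFDerivAt x ((hasStrictFDerivAt_norm_sq x).hasFDerivAt.add_const c)

/-- The partial derivative of a radial function `F (|x|² + c)`. -/
theorem partialDeriv_comp_norm_sq_add {F : ℝ → ℝ} {F' c : ℝ} {x : E N}
    (hF : HasDerivAt F F' (‖x‖ ^ 2 + c)) (i : Fin N) :
    partialDeriv i (fun y : E N ↦ F (‖y‖ ^ 2 + c)) x = F' * (2 * x i) := by
  rw [partialDeriv, (hasFDerivAt_comp_norm_sq_add hF).fderiv]
  simp [EuclideanSpace.inner_single_right]

/-- The Laplacian of a radial function `F (|x|² + c)`. -/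
theorem sum_partialDeriv_comp_norm_sq_add {F F' F'' : ℝ → ℝ} {c : ℝ} (hc : 0 < c)
    (h1 : ∀ t > 0, HasDerivAt F (F' t) t) (h2 : ∀ t > 0, HasDerivAt F' (F'' t) t) (x : E N) :
    ∑ i, partialDeriv i (partialDeriv i (fun y : E N ↦ F (‖y‖ ^ 2 + c))) x =
      4 * F'' (‖x‖ ^ 2 + c) * ‖x‖ ^ 2 + 2 * N * F' (‖x‖ ^ 2 + c) := by
  have hpos : ∀ y : E N, 0 < ‖y‖ ^ 2 + c := fun y ↦ by positivity
  have key : ∀ i, partialDeriv i (partialDeriv i (fun y : E N ↦ F (‖y‖ ^ 2 + c))) x =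
      4 * F'' (‖x‖ ^ 2 + c) * x i ^ 2 + 2 * F' (‖x‖ ^ 2 + c) := by
    intro i
    have e : partialDeriv i (fun y : E N ↦ F (‖y‖ ^ 2 + c)) =
        fun y ↦ F' (‖y‖ ^ 2 + c) * (2 * y i) :=
      funext fun y ↦ partialDeriv_comp_norm_sq_add (h1 _ (hpos y)) i
    have hlin : HasFDerivAt (fun y : E N ↦ 2 * y i)
        ((2 : ℝ) • (EuclideanSpace.proj i : E N →L[ℝ] ℝ)) x :=
      ((EuclideanSpace.proj i : E N →L[ℝ] ℝ).hasFDerivAt).const_mul 2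
    rw [e, partialDeriv, ((hasFDerivAt_comp_norm_sq_add (h2 _ (hpos x))).fun_mul hlin).fderiv]
    simp [EuclideanSpace.inner_single_right]
    ring
  simp_rw [key]
  rw [Finset.sum_add_distrib, ← Finset.mul_sum, EuclideanSpace.real_norm_sq_eq]
  simp
  ring

/-- The radial profile, as a function of `|x|² + r²`, of the logarithmic cutoff. -/
noncomputable def logProfile (a l t : ℝ) : ℝ := Real.smoothTransition ((a - Real.log t) / l)

theorem hasDerivAt_logProfile (a l : ℝ) {t : ℝ} (ht : 0 < t) :
    HasDerivAt (logProfile a l)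
      (deriv Real.smoothTransition ((a - Real.log t) / l) * (-t⁻¹ / l)) t := by
  have hsm : ContDiff ℝ (⊤ : ℕ∞) Real.smoothTransition := Real.smoothTransition.contDiff
  have h1 : HasDerivAt (fun t ↦ (a - Real.log t) / l) (-t⁻¹ / l) t :=
    ((Real.hasDerivAt_log ht.ne').const_sub a).div_const l
  exact ((hsm.differentiable (by simp) _).hasDerivAt).comp t h1

theorem hasDerivAt_deriv_logProfile (a l : ℝ) {t : ℝ} (ht : 0 < t) :
    HasDerivAt (fun t ↦ deriv Real.smoothTransition ((a - Real.log t) / l) * (-t⁻¹ / l))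
      (deriv (deriv Real.smoothTransition) ((a - Real.log t) / l) * (-t⁻¹ / l) ^ 2 +
        deriv Real.smoothTransition ((a - Real.log t) / l) * ((t ^ 2)⁻¹ / l)) t := by
  have hsm : ContDiff ℝ (⊤ : ℕ∞) Real.smoothTransition := Real.smoothTransition.contDiff
  have hd : ContDiff ℝ (⊤ : ℕ∞) (deriv Real.smoothTransition) :=
    ((contDiff_infty_iff_deriv (𝕜 := ℝ)).1 hsm).2
  have h1 : HasDerivAt (fun t ↦ (a - Real.log t) / l) (-t⁻¹ / l) t :=
    ((Real.hasDerivAt_log ht.ne').const_sub a).div_const l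
  have h2 := ((hd.differentiable (by simp) ((a - Real.log t) / l)).hasDerivAt).comp t h1
  have h3 : HasDerivAt (fun t : ℝ ↦ -t⁻¹ / l) ((t ^ 2)⁻¹ / l) t := by
    have := ((hasDerivAt_inv ht.ne').fun_neg).div_const l
    rwa [neg_neg] at this
  exact (h2.fun_mul h3).congr_deriv (by simp only [Function.comp_apply]; ring)

end LogCutoff
-- Necessity: testing with logarithmic cutoffs
section Necessity

/-- Each derivative of the profile in `D = |x|² + r²` gains `1 / D`, and at least one factor `1 / l`
always appears, so `Δ` is `O(1 / (l D))`. The condition `l ≥ 1 / 2` absorbs the second `1 / l`; then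
`20 = 4 · (2 + 1) + 8`. -/
theorem sq_laplacian_logProfile_le {K : ℝ}
    (hK : ∀ s, |deriv Real.smoothTransition s| ≤ K ∧ |deriv (deriv Real.smoothTransition) s| ≤ K)
    (a : ℝ) {l r : ℝ} (hl : 1 / 2 ≤ l) (hr : 0 < r) (x : E 4) :
    (∑ i, partialDeriv i (partialDeriv i fun y : E 4 ↦ logProfile a l (‖y‖ ^ 2 + r ^ 2)) x) ^ 2 ≤
      (20 * K / l) ^ 2 * ((‖x‖ ^ 2 + r ^ 2) ^ 2)⁻¹ := by
  have hK0 : 0 ≤ K := (abs_nonneg _).trans (hK 0).1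
  have hl0 : 0 < l := by linarith
  rw [sum_partialDeriv_comp_norm_sq_add (by positivity) (fun t ht ↦ hasDerivAt_logProfile a l ht)
    (fun t ht ↦ hasDerivAt_deriv_logProfile a l ht)]
  set D := ‖x‖ ^ 2 + r ^ 2 with hD
  have hD0 : 0 < D := by positivity
  have hxD : ‖x‖ ^ 2 ≤ D := by rw [hD]; nlinarith [sq_nonneg r]
  obtain ⟨h1, h2⟩ := hK ((a - Real.log D) / l)
  generalize deriv Real.smoothTransition ((a - Real.log D) / l) = p at *
  generalize deriv (deriv Real.smoothTransition) ((a - Real.log D) / l) = q at *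
  have e : 4 * (q * (-D⁻¹ / l) ^ 2 + p * ((D ^ 2)⁻¹ / l)) * ‖x‖ ^ 2 +
      2 * ((4 : ℕ) : ℝ) * (p * (-D⁻¹ / l)) =
      (4 * (q / l + p) * (‖x‖ ^ 2 / D) - 8 * p) / (l * D) := by
    push_cast
    field_simp
    ring
  rw [e, div_pow]
  have h3 : |4 * (q / l + p) * (‖x‖ ^ 2 / D) - 8 * p| ≤ 20 * K := by
    have hq : |q / l| ≤ 2 * K := by
      rw [abs_div, abs_of_pos hl0, div_le_iff₀ hl0]
      nlinarith
    have hxd : ‖x‖ ^ 2 / D ≤ 1 := (div_le_one hD0).2 hxD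
    have hxd0 : 0 ≤ ‖x‖ ^ 2 / D := by positivity
    calc _ ≤ |4 * (q / l + p) * (‖x‖ ^ 2 / D)| + |8 * p| := abs_sub _ _
      _ = 4 * |q / l + p| * (‖x‖ ^ 2 / D) + 8 * |p| := by
          rw [abs_mul, abs_mul, abs_mul, abs_of_nonneg hxd0]
          norm_num
      _ ≤ 4 * (2 * K + K) * 1 + 8 * K := by
          gcongr
          exact (abs_add_le _ _).trans (add_le_add hq h1)
      _ = _ := by ring
  have h4 := sq_le_sq' (abs_le.1 h3).1 (abs_le.1 h3).2
  calc _ ≤ (20 * K) ^ 2 / (l * D) ^ 2 := by gcongr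
    _ = _ := by field_simp

/-- In polar coordinates the integrand `t³ / (t² + r²)²` is at most `t / (t² + r²)`, which has a
logarithmic primitive. The constant is `4 · 1 / 2`, where `4` is the dimension. -/
theorem lintegral_ball_inv_sq_le {R r : ℝ} (hR : 0 < R) (hr : 0 < r) :
    ∫⁻ x in Metric.ball (0 : E 4) R, ENNReal.ofReal (((‖x‖ ^ 2 + r ^ 2) ^ 2)⁻¹) ≤
      ENNReal.ofReal (2 * volume.real (Metric.ball (0 : E 4) 1) *
        (Real.log (R ^ 2 + r ^ 2) - Real.log (r ^ 2))) := by
  have hcont : Continuous fun x : E 4 ↦ ((‖x‖ ^ 2 + r ^ 2) ^ 2)⁻¹ :=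
    Continuous.inv₀ (by fun_prop) fun x ↦ by positivity
  have hint : IntegrableOn (fun x : E 4 ↦ ((‖x‖ ^ 2 + r ^ 2) ^ 2)⁻¹) (Metric.ball 0 R) :=
    (hcont.continuousOn.integrableOn_compact (isCompact_closedBall 0 R)).mono_set
      Metric.ball_subset_closedBall
  rw [← ofReal_integral_eq_lintegral_ofReal hint (Eventually.of_forall fun x ↦ by positivity)]
  refine ENNReal.ofReal_le_ofReal ?_
  have e1 : ∫ x in Metric.ball (0 : E 4) R, ((‖x‖ ^ 2 + r ^ 2) ^ 2)⁻¹ =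
      ∫ x : E 4, (Iio R).indicator (fun t ↦ ((t ^ 2 + r ^ 2) ^ 2)⁻¹) ‖x‖ := by
    rw [← integral_indicator measurableSet_ball]
    refine integral_congr_ae (Eventually.of_forall fun x ↦ ?_)
    simp [indicator]
  have hcont2 : Continuous fun t : ℝ ↦ t * (t ^ 2 + r ^ 2)⁻¹ :=
    continuous_id.mul (Continuous.inv₀ (by fun_prop) fun x ↦ by positivity)
  have hcont3 : Continuous fun t : ℝ ↦ t ^ 3 * ((t ^ 2 + r ^ 2) ^ 2)⁻¹ :=
    (continuous_pow 3).mul (Continuous.inv₀ (by fun_prop) fun x ↦ by positivity)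
  have e2 : ∫ t in Ioi (0 : ℝ), t ^ (4 - 1) •
        (Iio R).indicator (fun t ↦ ((t ^ 2 + r ^ 2) ^ 2)⁻¹) t =
      ∫ t in 0..R, t ^ 3 * ((t ^ 2 + r ^ 2) ^ 2)⁻¹ := by
    rw [intervalIntegral.integral_of_le hR.le, integral_Ioc_eq_integral_Ioo,
      ← integral_indicator measurableSet_Ioi, ← integral_indicator measurableSet_Ioo]
    refine integral_congr_ae (Eventually.of_forall fun t ↦ ?_)
    by_cases h0 : 0 < t <;> by_cases h1 : t < R <;> simp [indicator, h0, h1]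
  have e3 : ∫ t in 0..R, t * (t ^ 2 + r ^ 2)⁻¹ =
      1 / 2 * (Real.log (R ^ 2 + r ^ 2) - Real.log (r ^ 2)) := by
    have hder : ∀ t ∈ uIcc 0 R, HasDerivAt (fun t : ℝ ↦ 1 / 2 * Real.log (t ^ 2 + r ^ 2))
        (t * (t ^ 2 + r ^ 2)⁻¹) t := by
      intro t _
      have h : HasDerivAt (fun t : ℝ ↦ t ^ 2 + r ^ 2) (2 * t) t := by
        simpa using (hasDerivAt_pow 2 t).add_const (r ^ 2)
      exact ((h.log (by positivity)).const_mul (1 / 2)).congr_deriv (by field_simp)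
    rw [intervalIntegral.integral_eq_sub_of_hasDerivAt hder (hcont2.intervalIntegrable _ _)]
    simp only [ne_eq, OfNat.ofNat_ne_zero, not_false_eq_true, zero_pow, zero_add]
    ring
  have e4 : ∫ t in 0..R, t ^ 3 * ((t ^ 2 + r ^ 2) ^ 2)⁻¹ ≤ ∫ t in 0..R, t * (t ^ 2 + r ^ 2)⁻¹ := by
    refine intervalIntegral.integral_mono_on hR.le (hcont3.intervalIntegrable _ _)
      (hcont2.intervalIntegrable _ _) fun t ht ↦ ?_
    have ht0 : 0 ≤ t := ht.1
    rw [← div_eq_mul_inv, ← div_eq_mul_inv, div_le_div_iff₀ (by positivity) (by positivity)]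
    have h1 : 0 ≤ t * (t ^ 2 + r ^ 2) * r ^ 2 := by positivity
    linear_combination h1
  have hmain := integral_fun_norm_addHaar (volume : Measure (E 4))
    ((Iio R).indicator (fun t ↦ ((t ^ 2 + r ^ 2) ^ 2)⁻¹))
  rw [finrank_euclideanSpace, Fintype.card_fin, e2, nsmul_eq_mul, smul_eq_mul] at hmain
  rw [e1, hmain]
  calc _ ≤ ((4 : ℕ) : ℝ) * (volume.real (Metric.ball (0 : E 4) 1) *
        (1 / 2 * (Real.log (R ^ 2 + r ^ 2) - Real.log (r ^ 2)))) := by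
        gcongr
        exact e4.trans e3.le
    _ = _ := by
        push_cast
        ring

/-- The logarithmic cutoff is a test function on the ball of radius `R`. -/
theorem exists_testFunction_eq_logProfile {Ω : Opens (E 4)} {R r l : ℝ} (hR : 0 < R)
    (hΩ : (Ω : Set (E 4)) = Metric.ball 0 R) (hr : 0 < r) (hl : 0 < l) :
    ∃ φ : 𝓓(Ω, ℝ), (φ : E 4 → ℝ) = fun y ↦ logProfile (Real.log (R ^ 2)) l (‖y‖ ^ 2 + r ^ 2) := by
  have hsub : tsupport (fun y : E 4 ↦ logProfile (Real.log (R ^ 2)) l (‖y‖ ^ 2 + r ^ 2)) ⊆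
      {y | ‖y‖ ^ 2 + r ^ 2 ≤ R ^ 2} := by
    refine closure_minimal (fun y hy ↦ ?_) (isClosed_le (by fun_prop) continuous_const)
    by_contra hlt
    refine hy (Real.smoothTransition.zero_of_nonpos (div_nonpos_of_nonpos_of_nonneg ?_ hl.le))
    have := Real.log_le_log (by positivity) (not_le.1 hlt).le
    linarith
  have hball : {y : E 4 | ‖y‖ ^ 2 + r ^ 2 ≤ R ^ 2} ⊆ Metric.ball 0 R := fun y hy ↦ by
    have hy : ‖y‖ ^ 2 + r ^ 2 ≤ R ^ 2 := hy
    rw [mem_ball_zero_iff]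
    exact lt_of_pow_lt_pow_left₀ 2 hR.le (by nlinarith [sq_pos_of_pos hr])
  have hsm : ContDiff ℝ (⊤ : ℕ∞) Real.smoothTransition := Real.smoothTransition.contDiff
  have hcd : ContDiff ℝ (⊤ : ℕ∞)
      fun y : E 4 ↦ logProfile (Real.log (R ^ 2)) l (‖y‖ ^ 2 + r ^ 2) := by
    refine hsm.comp (ContDiff.div_const (contDiff_const.sub (ContDiff.log ?_ fun y ↦ ?_)) l)
    · exact (contDiff_norm_sq ℝ).add contDiff_const
    · positivity
  exact ⟨⟨_, hcd, HasCompactSupport.of_support_subset_isCompact (isCompact_closedBall (0 : E 4) R)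
    ((subset_tsupport _).trans (hsub.trans (hball.trans Metric.ball_subset_closedBall))),
    hΩ ▸ hsub.trans hball⟩, rfl⟩

/-- Logarithmic decay of the mass of an admissible weight on small centered balls. -/
theorem exists_log_mul_setLIntegral_ball_le {Ω : Opens (E 4)} {g : E 4 → ℝ≥0∞} {R : ℝ}
    (hR : 0 < R) (hΩ : (Ω : Set (E 4)) = Metric.ball 0 R) (hg : Admissible Ω g) :
    ∃ M : ℝ≥0∞, M ≠ ∞ ∧ ∀ r, 0 < r → r ≤ R / 2 →
      ENNReal.ofReal (Real.log (R / r)) * ∫⁻ x in Metric.ball (0 : E 4) r, g x ≤ M := by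
  obtain ⟨-, -, C, hC, hineq⟩ := hg
  obtain ⟨K, hK0, hK⟩ := exists_bound_deriv_smoothTransition
  set ω := volume.real (Metric.ball (0 : E 4) 1) with hω
  refine ⟨ENNReal.ofReal (C * (2400 * K ^ 2 * ω)), ENNReal.ofReal_ne_top, fun r hr hrR ↦ ?_⟩
  have hlog : Real.log 2 ≤ Real.log (R / r) :=
    Real.log_le_log (by norm_num) (by rw [le_div_iff₀ hr]; linarith)
  have hlog2 : 1 / 2 ≤ Real.log 2 := by linarith [Real.log_two_gt_d9]
  -- This is `log (R² / (2r²))`: the profile descends from `1` at `|x|² + r² = 2r²`, the sphere of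
  -- radius `r`, to `0` at `|x|² + r² = R²`. The bound `r ≤ R / 2` gives `l ≥ log 2 ≥ 1 / 2`.
  set l : ℝ := 2 * Real.log (R / r) - Real.log 2 with hl_def
  have hl : Real.log (R / r) ≤ l := by linarith
  have hl0 : 0 < l := by linarith
  obtain ⟨φ, hφ⟩ := exists_testFunction_eq_logProfile hR hΩ hr hl0
  have hlogR : Real.log (R ^ 2) - Real.log (2 * r ^ 2) = l := by
    rw [hl_def, Real.log_mul (by norm_num) (by positivity), Real.log_pow, Real.log_pow,
      Real.log_div hR.ne' hr.ne']
    push_cast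
    ring
  have hone : ∀ x ∈ Metric.ball (0 : E 4) r, φ x = 1 := fun x hx ↦ by
    rw [mem_ball_zero_iff] at hx
    rw [hφ]
    refine Real.smoothTransition.one_of_one_le ((one_le_div hl0).2 ?_)
    rw [← hlogR]
    gcongr
    nlinarith [norm_nonneg x]
  have hball : Metric.ball (0 : E 4) r ⊆ Ω := by
    rw [hΩ]
    exact Metric.ball_subset_ball (by linarith)
  -- The left side is at most `log (2R² / r²) = l + 2 log 2`, and `log 2 ≤ l`.
  have hsum : Real.log (R ^ 2 + r ^ 2) - Real.log (r ^ 2) ≤ 3 * l := by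
    have h1 : Real.log (R ^ 2 + r ^ 2) ≤ Real.log (2 * R ^ 2) :=
      Real.log_le_log (by positivity) (by nlinarith)
    rw [Real.log_mul (by norm_num) (by positivity), Real.log_pow] at h1
    rw [Real.log_mul (by norm_num) (by positivity), Real.log_pow, Real.log_pow] at hlogR
    rw [Real.log_pow]
    push_cast at *
    linarith
  have hmain : ∫⁻ x in Metric.ball (0 : E 4) r, g x ≤
      ENNReal.ofReal (C * ((20 * K / l) ^ 2 * (2 * ω * (3 * l)))) := by
    calc ∫⁻ x in Metric.ball (0 : E 4) r, g x
        = ∫⁻ x in Metric.ball (0 : E 4) r, g x * ENNReal.ofReal (φ x ^ 2) :=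
          setLIntegral_congr_fun measurableSet_ball fun x hx ↦ by simp [hone x hx]
      _ ≤ ∫⁻ x in (Ω : Set (E 4)), g x * ENNReal.ofReal (φ x ^ 2) := lintegral_mono_set hball
      _ ≤ ENNReal.ofReal C * ∫⁻ x in (Ω : Set (E 4)), ENNReal.ofReal
            ((∑ i, partialDeriv i (partialDeriv i φ) x) ^ 2) :=
          hineq _ _ _ (isH20_testFunction φ)
      _ ≤ ENNReal.ofReal C * ∫⁻ x in (Ω : Set (E 4)), ENNReal.ofReal ((20 * K / l) ^ 2) *
            ENNReal.ofReal (((‖x‖ ^ 2 + r ^ 2) ^ 2)⁻¹) := by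
          gcongr with x
          rw [← ENNReal.ofReal_mul (by positivity), hφ]
          exact ENNReal.ofReal_le_ofReal (sq_laplacian_logProfile_le hK _ (by linarith) hr x)
      _ ≤ ENNReal.ofReal C * (ENNReal.ofReal ((20 * K / l) ^ 2) *
            ENNReal.ofReal (2 * ω * (3 * l))) := by
          rw [lintegral_const_mul' _ _ ENNReal.ofReal_ne_top, hΩ]
          gcongr
          refine (lintegral_ball_inv_sq_le hR hr).trans (ENNReal.ofReal_le_ofReal ?_)
          gcongr
      _ = _ := by
          rw [← ENNReal.ofReal_mul (by positivity), ← ENNReal.ofReal_mul hC.le]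
  -- The energy is `O(1 / l)`, from `l⁻²` times a logarithm of size `3 l`, so multiplying by `l`
  -- leaves `400 · 2 · 3 = 2400`.
  calc _ ≤ ENNReal.ofReal l * ENNReal.ofReal (C * ((20 * K / l) ^ 2 * (2 * ω * (3 * l)))) := by
        gcongr
    _ = _ := by
        rw [← ENNReal.ofReal_mul hl0.le]
        congr 1
        field_simp
        ring

/-- Radially decreasing admissible weights on a ball belong to `𝓜 log L`. -/
theorem memMLogL_of_admissible {Ω : Opens (E 4)} {g : E 4 → ℝ≥0∞} {R : ℝ} (hR : 0 < R)
    (hΩ : (Ω : Set (E 4)) = Metric.ball 0 R) (hdec : IsRadiallyDecreasing Ω g)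
    (hg : Admissible Ω g) : MemMLogL Ω g := by
  obtain ⟨M, hM, hMr⟩ := exists_log_mul_setLIntegral_ball_le hR hΩ hg
  have hfin := lintegral_lt_top_of_isRadiallyDecreasing hR hΩ hdec hg.2.1
  refine ⟨hg.1, ?_⟩
  set I := ∫⁻ x in (Ω : Set (E 4)), g x with hI
  set ω := volume.real (Metric.ball (0 : E 4) 1) with hω
  have hω0 : 0 < ω := ENNReal.toReal_pos (Metric.measure_ball_pos volume _ one_pos).ne'
    measure_ball_lt_top.ne
  have hvol : ∀ r : ℝ, 0 < r → volume.real (Metric.ball (0 : E 4) r) = r ^ 4 * ω := fun r hr ↦ by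
    rw [Measure.real, Measure.addHaar_ball_of_pos _ _ hr, ENNReal.toReal_mul,
      ENNReal.toReal_ofReal (by positivity), finrank_euclideanSpace, Fintype.card_fin, hω,
      Measure.real]
  suffices h : mLogLNorm Ω g ≤ 4 * M + ENNReal.ofReal (4 * Real.log 2) * I from
    h.trans_lt (ENNReal.add_lt_top.2 ⟨ENNReal.mul_lt_top (by norm_num) hM.lt_top,
      ENNReal.mul_lt_top ENNReal.ofReal_lt_top hfin⟩)
  refine iSup₂_le fun t ht ↦ ?_
  rw [hΩ, hvol R hR] at ht ⊢
  rw [ofReal_mul_maximalRearrangement ht.1]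
  -- The radius of the centered ball of measure `t`, so that `log (|Ω| / t) = 4 log (R / r)`.
  set r := (t / ω) ^ (1 / 4 : ℝ) with hr_def
  have hr0 : 0 < r := Real.rpow_pos_of_pos (div_pos ht.1 hω0) _
  have hr4 : r ^ 4 = t / ω := by
    rw [hr_def, ← Real.rpow_natCast, ← Real.rpow_mul (div_pos ht.1 hω0).le]
    norm_num
  have ht' : t = r ^ 4 * ω := by rw [hr4, div_mul_cancel₀ _ hω0.ne']
  have hrR : r < R := by
    have := ht.2
    rw [ht'] at this
    exact lt_of_pow_lt_pow_left₀ 4 hR.le (lt_of_mul_lt_mul_right this hω0.le)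
  have hball : Metric.ball (0 : E 4) r ⊆ Ω := by
    rw [hΩ]
    exact Metric.ball_subset_ball hrR.le
  have hle := lintegral_rearrangement_le_setLIntegral_ball hg.1 hdec hball
  rw [hvol r hr0, ← ht'] at hle
  have hlog : Real.log (R ^ 4 * ω / t) = 4 * Real.log (R / r) := by
    rw [ht', mul_div_mul_right _ _ hω0.ne', ← div_pow, Real.log_pow]
    norm_num
  rw [hlog]
  -- The cutoff estimate covers small radii. For `r > R / 2` the logarithm is at most `log 2` and
  -- the total mass of `g` suffices.
  rcases le_or_gt r (R / 2) with h | h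
  · refine le_trans ?_ le_self_add
    rw [ENNReal.ofReal_mul (by norm_num), mul_assoc, show ENNReal.ofReal 4 = 4 by simp]
    gcongr
    refine le_trans ?_ (hMr r hr0 h)
    gcongr
  · refine le_trans ?_ le_add_self
    gcongr
    · rw [div_le_iff₀ hr0]
      linarith
    · exact hle.trans (lintegral_mono_set hball)

end Necessity
end HardyRellich

theorem theorem1p3 (Ω : Opens (HardyRellich.E 4))
    (hΩ : Bornology.IsBounded (Ω : Set (HardyRellich.E 4)))
    (g : HardyRellich.E 4 → ℝ≥0∞)
    (hg : AEMeasurable g (volume.restrict (Ω : Set (HardyRellich.E 4)))) :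
    (HardyRellich.MemMLogL Ω g → HardyRellich.Admissible Ω g) ∧
    (∀ R : ℝ, 0 < R → (Ω : Set (HardyRellich.E 4)) = Metric.ball 0 R →
      HardyRellich.IsRadial Ω g → HardyRellich.IsRadiallyDecreasing Ω g →
      HardyRellich.Admissible Ω g → HardyRellich.MemMLogL Ω g) :=
  ⟨fun h ↦ HardyRellich.admissible_of_memMLogL hΩ.measure_lt_top.ne h,
    fun _ hR hball _ hdec h ↦ HardyRellich.memMLogL_of_admissible hR hball hdec h⟩
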